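/- Let $D(\mathbb{Z}^2)=\mathbb{G}_m^2$ act over $\operatorname{Spec}\mathbb{Z}$ on $X=\mathbb{P}^2$ by $(\lambda,\beta)\cdot[x:y:z]=[\lambda x:\beta y:z]$. For a submonoid $N\subset\mathbb{Z}^2$ (a magnet) let $A(N)=\operatorname{Spec}\mathbb{Z}[N]$, and let $X^N$ be the functor sending a scheme $T$ to the set of $D(\mathbb{Z}^2)_T$-equivariant $T$-morphisms $A(N)_T\to X_T$; evaluation at the unit section of $A(N)_T$ is a monomorphism $X^N\to X$, through which $X^N$ is regarded as a subobject of $X$. A magnet $N$ is called pure if it is the least (for inclusion) of the magnets $N'$ with $X^{N'}=X^N$ as subobjects of $X$. A magnet $N$ is called lambdafiable if there is a group homomorphism $f:\mathbb{Z}^2\to\mathbb{Z}$ with $X^{f^{-1}(\mathbb{N})}=X^N$, where $\mathbb{N}=\{0,1,2,\dots\}$. Let $\Phi=\{(1,0),(0,1),(1,-1),(0,-1),(-1,1),(-1,0)\}\subset\mathbb{Z}^2$. For $E\subset\Phi$ let $[E\rangle$ be the submonoid of $\mathbb{Z}^2$ generated by $E$, and call $E$ additively stable if $[E\rangle\cap\Phi=E$.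 For every additively stable $E\subset\Phi$, the magnet $[E\rangle$ is pure, and it is lambdafiable if and only if $\#E\ge 3$. There are exactly 29 pure magnets; 13 of them are lambdafiable and 16 are not. -/

import Mathlib

open CategoryTheory AlgebraicGeometry MonoidalCategory CartesianMonoidalCategory

noncomputable section

namespace Magnetism

/-! ### Morphisms to an affine scheme -/

/-- The ring homomorphism `R → Γ(Y, 𝒪)` of a morphism `Y ⟶ Spec R`. -/
def toSections {R : Type} [CommRing R] {Y : Scheme.{0}} (p : Y ⟶ Spec (CommRingCat.of R)) :
    R →+* Γ(Y, ⊤) :=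
  ((Scheme.ΓSpecIso (CommRingCat.of R)).inv ≫ p.appTop).hom

/-- The morphism `Y ⟶ Spec R` of a ring homomorphism `R → Γ(Y, 𝒪)`. -/
def ofSections {R : Type} [CommRing R] {Y : Scheme.{0}} (φ : R →+* Γ(Y, ⊤)) :
    Y ⟶ Spec (CommRingCat.of R) :=
  Y.toSpecΓ ≫ Spec.map (CommRingCat.ofHom φ)

lemma toSections_ofSections {R : Type} [CommRing R] {Y : Scheme.{0}} (φ : R →+* Γ(Y, ⊤)) :
    toSections (ofSections φ) = φ := by
  unfold toSections ofSections
  rw [Scheme.Hom.comp_appTop, ← Category.assoc, ← Scheme.ΓSpecIso_inv_naturality, Category.assoc,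
    Scheme.toSpecΓ_appTop, Iso.inv_hom_id, Category.comp_id, CommRingCat.hom_ofHom]

lemma toSections_injective {R : Type} [CommRing R] {Y : Scheme.{0}}
    {p q : Y ⟶ Spec (CommRingCat.of R)} (h : toSections p = toSections q) : p = q :=
  ext_to_Spec (CommRingCat.hom_ext h)

lemma ofSections_toSections {R : Type} [CommRing R] {Y : Scheme.{0}}
    (p : Y ⟶ Spec (CommRingCat.of R)) : ofSections (toSections p) = p :=
  toSections_injective (toSections_ofSections _)

lemma toSections_comp {R : Type} [CommRing R] {Y Z : Scheme.{0}} (h : Z ⟶ Y)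
    (p : Y ⟶ Spec (CommRingCat.of R)) :
    toSections (h ≫ p) = h.appTop.hom.comp (toSections p) := by
  unfold toSections
  rw [Scheme.Hom.comp_appTop, ← Category.assoc, CommRingCat.hom_comp]

lemma toSections_map {R S : Type} [CommRing R] [CommRing S] {Y : Scheme.{0}} (φ : R →+* S)
    (p : Y ⟶ Spec (CommRingCat.of S)) :
    toSections (p ≫ Spec.map (CommRingCat.ofHom φ)) = (toSections p).comp φ := by
  unfold toSections
  rw [Scheme.Hom.comp_appTop, ← Category.assoc, ← Scheme.ΓSpecIso_inv_naturality,
    Category.assoc, CommRingCat.hom_comp, CommRingCat.hom_ofHom]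

/-! ### Diagonalizable monoid schemes -/

/-- The diagonalizable monoid scheme `A(N) = Spec ℤ[N]` of a commutative monoid `N`. For an abelian
group `M`, this is the diagonalizable group scheme `D(M)`. -/
def diag (N : Type) [AddCommMonoid N] : Scheme.{0} := Spec (CommRingCat.of (AddMonoidAlgebra ℤ N))

/-- The monoid homomorphism `N → (Γ(Y, 𝒪), ·)` of a `Y`-point of `A(N)`. -/
def pointChar {N : Type} [AddCommMonoid N] {Y : Scheme.{0}} (p : Y ⟶ diag N) :
    Multiplicative N →* Γ(Y, ⊤) :=
  (toSections p : AddMonoidAlgebra ℤ N →* Γ(Y, ⊤)).comp (AddMonoidAlgebra.of ℤ N)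

/-- The `Y`-point of `A(N)` of a monoid homomorphism `N → (Γ(Y, 𝒪), ·)`. -/
def charPoint {N : Type} [AddCommMonoid N] {Y : Scheme.{0}} (c : Multiplicative N →* Γ(Y, ⊤)) :
    Y ⟶ diag N :=
  ofSections (AddMonoidAlgebra.lift ℤ Γ(Y, ⊤) N c).toRingHom

lemma pointChar_charPoint {N : Type} [AddCommMonoid N] {Y : Scheme.{0}}
    (c : Multiplicative N →* Γ(Y, ⊤)) : pointChar (charPoint c) = c := by
  ext n
  simp only [pointChar, charPoint, toSections_ofSections]
  exact AddMonoidAlgebra.lift_of c n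

lemma pointChar_injective {N : Type} [AddCommMonoid N] {Y : Scheme.{0}} {p q : Y ⟶ diag N}
    (h : pointChar p = pointChar q) : p = q := by
  refine toSections_injective (AddMonoidAlgebra.ringHom_ext' (RingHom.ext_int _ _) h)

lemma pointChar_comp {N : Type} [AddCommMonoid N] {Y Z : Scheme.{0}} (h : Z ⟶ Y) (p : Y ⟶ diag N) :
    pointChar (h ≫ p) = (h.appTop.hom : Γ(Y, ⊤) →* Γ(Z, ⊤)).comp (pointChar p) := by
  ext n
  exact congr($(toSections_comp h p) (AddMonoidAlgebra.of ℤ N n))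

/-- The unit `Y`-point of the monoid scheme `A(N)`. -/
def onePoint (N : Type) [AddCommMonoid N] (Y : Scheme.{0}) : Y ⟶ diag N := charPoint 1

/-- The product of two `Y`-points of the monoid scheme `A(N)`. -/
def mulPoint {N : Type} [AddCommMonoid N] {Y : Scheme.{0}} (p q : Y ⟶ diag N) : Y ⟶ diag N :=
  charPoint (pointChar p * pointChar q)

/-- The morphism `A(M) ⟶ A(N)` of an inclusion `N ⊆ M`, on `Y`-points. -/
def restrictPoint {M : Type} [AddCommMonoid M] (N : AddSubmonoid M) {Y : Scheme.{0}}
    (g : Y ⟶ diag M) : Y ⟶ diag N :=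
  charPoint ((pointChar g).comp (AddMonoidHom.toMultiplicative N.subtype))

lemma comp_onePoint (N : Type) [AddCommMonoid N] {Y Z : Scheme.{0}} (h : Z ⟶ Y) :
    h ≫ onePoint N Y = onePoint N Z := by
  apply pointChar_injective
  rw [pointChar_comp, onePoint, onePoint, pointChar_charPoint, pointChar_charPoint]
  ext n
  simp

/-! ### Actions of diagonalizable group schemes, and attractors -/

/-- An action of the diagonalizable group scheme `D(M)` on a scheme `X` (over `Spec ℤ`). -/
structure DiagAction (M : Type) [AddCommGroup M] (X : Scheme.{0}) where
  act : diag M ⊗ X ⟶ X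
  one_act : ∀ (Y : Scheme.{0}) (x : Y ⟶ X), lift (onePoint M Y) x ≫ act = x
  mul_act : ∀ (Y : Scheme.{0}) (g h : Y ⟶ diag M) (x : Y ⟶ X),
    lift (mulPoint g h) x ≫ act = lift g (lift h x ≫ act) ≫ act

variable {M : Type} [AddCommGroup M] {X : Scheme.{0}}

/-- A morphism `A(N)_T ⟶ X_T` over `T` is the same as a morphism `φ : A(N) × T ⟶ X`. It is
equivariant for `D(M)_T`, which acts on `A(N)_T` through `D(M) ⟶ A(N)` and multiplication, if
`φ(g · n, t) = g · φ(n, t)` on points with values in arbitrary schemes. -/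
def IsEquivariant (a : DiagAction M X) (N : AddSubmonoid M) {T : Scheme.{0}}
    (φ : diag N ⊗ T ⟶ X) : Prop :=
  ∀ (Y : Scheme.{0}) (g : Y ⟶ diag M) (n : Y ⟶ diag N) (t : Y ⟶ T),
    lift (mulPoint (restrictPoint N g) n) t ≫ φ = lift g (lift n t ≫ φ) ≫ a.act

/-- The functor `X^N`, sending a scheme `T` to the set of equivariant morphisms
`A(N)_T ⟶ X_T` over `T`. -/
def attractorFunctor (a : DiagAction M X) (N : AddSubmonoid M) : Scheme.{0}ᵒᵖ ⥤ Type where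
  obj T := {φ : diag N ⊗ T.unop ⟶ X // IsEquivariant a N φ}
  map {T T'} h := ↾fun φ => ⟨diag N ◁ h.unop ≫ φ.1, fun Y g n t => by
    have := φ.2 Y g n (t ≫ h.unop)
    simpa using this⟩

/-- The canonical morphism `X^N ⟶ X`: evaluation at the unit section of `A(N)`. -/
def attractorι (a : DiagAction M X) (N : AddSubmonoid M) :
    attractorFunctor a N ⟶ yoneda.obj X where
  app T := ↾fun φ => lift (onePoint N T.unop) (𝟙 T.unop) ≫ φ.1
  naturality T T' h := by
    ext φ
    change lift _ (𝟙 _) ≫ diag N ◁ h.unop ≫ φ.1 = h.unop ≫ lift _ (𝟙 _) ≫ φ.1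
    rw [lift_whiskerLeft_assoc, comp_lift_assoc, comp_onePoint, Category.id_comp,
      Category.comp_id]

/-- The attractor `X^N` as a subobject of `X`, that is, the image of `X^N ⟶ X` (a monomorphism when
`X` is separated) as a subfunctor of the functor of points of `X`. An equality `X^N = X^{N'}` means
that these subfunctors have the same `T`-points for all schemes `T`. -/
def attractor (a : DiagAction M X) (N : AddSubmonoid M) : Subfunctor (yoneda.obj X) :=
  Subfunctor.range (attractorι a N)

/-- The class `m^N(a)` of the magnets (submonoids of `M`) that have the same attractor as `N`. -/
def magnetClass (a : DiagAction M X) (N : AddSubmonoid M) : Set (AddSubmonoid M) :=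
  {N' | attractor a N = attractor a N'}

/-- A magnet is pure if it is the least element of its class. -/
def IsPure (a : DiagAction M X) (N : AddSubmonoid M) : Prop := IsLeast (magnetClass a N) N

/-- A magnet `N` is lambdafiable if `X^{f⁻¹(ℕ)} = X^N` for some homomorphism `f : M → ℤ`. -/
def IsLambdafiable (a : DiagAction M X) (N : AddSubmonoid M) : Prop :=
  ∃ f : M →+ ℤ, attractor a ((AddSubmonoid.nonneg ℤ).comap f) = attractor a N

/-! ### Homogeneous coordinates on the projective plane -/

/-- The grading of `ℤ[x₀, x₁, x₂]` by degree. -/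
abbrev planeGrading : ℕ → Submodule ℤ (MvPolynomial (Fin 3) ℤ) :=
  MvPolynomial.homogeneousSubmodule (Fin 3) ℤ

instance : GradedRing planeGrading := MvPolynomial.gradedAlgebra

/-- The coordinate ring `ℤ[x₀, x₁, x₂, 1 / s]₀` of the open subscheme `s ≠ 0`. -/
abbrev Away₀ (s : MvPolynomial (Fin 3) ℤ) : Type := HomogeneousLocalization.Away planeGrading s

/-- The projective plane over `Spec ℤ`. -/
def plane : Scheme.{0} := Proj planeGrading

lemma map_aeval_int {R S : Type} [CommRing R] [CommRing S] [Algebra ℤ R] [Algebra ℤ S] (φ : R →+* S) (v : Fin 3 → R)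
    (p : MvPolynomial (Fin 3) ℤ) :
    φ (MvPolynomial.aeval v p) = MvPolynomial.aeval (fun j => φ (v j)) p :=
  MvPolynomial.comp_aeval_apply (R := ℤ) v (AlgHom.mk φ fun n => by
    change φ (algebraMap ℤ R n) = algebraMap ℤ S n
    rw [eq_intCast (algebraMap ℤ R) n, map_intCast, eq_intCast (algebraMap ℤ S) n]) p

/-- The ring homomorphism `ℤ[x₀, x₁, x₂, 1 / s]₀ → R`, `p / s ^ n ↦ p(v) / s(v) ^ n`, for a
vector `v` such that `s(v)` is invertible. -/
def awayEval {R : Type} [CommRing R] (v : Fin 3 → R) (s : MvPolynomial (Fin 3) ℤ)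
    (hs : IsUnit (MvPolynomial.aeval v s)) : Away₀ s →+* R :=
  (IsLocalization.Away.lift (S := Localization.Away s) s
    (g := (MvPolynomial.aeval v : MvPolynomial (Fin 3) ℤ →ₐ[ℤ] R).toRingHom) hs).comp
    (algebraMap _ _)

lemma awayEval_mk {R : Type} [CommRing R] (v : Fin 3 → R) {s : MvPolynomial (Fin 3) ℤ}
    (hs : IsUnit (MvPolynomial.aeval v s)) {d : ℕ} (hd : s ∈ planeGrading d) (n : ℕ)
    (p : MvPolynomial (Fin 3) ℤ) (hp : p ∈ planeGrading (n • d)) :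
    awayEval v s hs (.mk planeGrading hd n p hp) * MvPolynomial.aeval v s ^ n =
      MvPolynomial.aeval v p := by
  have key : ∀ q : MvPolynomial (Fin 3) ℤ, MvPolynomial.aeval v q =
      IsLocalization.Away.lift (S := Localization.Away s) s
        (g := (MvPolynomial.aeval v : MvPolynomial (Fin 3) ℤ →ₐ[ℤ] R).toRingHom) hs
        (algebraMap _ _ q) := fun q => by
    rw [IsLocalization.Away.lift_eq]; rfl
  rw [key s, key p, ← map_pow, awayEval, RingHom.comp_apply, ← map_mul,
    HomogeneousLocalization.algebraMap_apply, HomogeneousLocalization.Away.val_mk,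
    ← map_pow (algebraMap _ _), Localization.mk_eq_mk'_apply]
  congr 1
  exact IsLocalization.mk'_spec _ p (⟨s ^ n, n, rfl⟩ : Submonoid.powers s)

lemma awayEval_ext {R : Type} [CommRing R] {s : MvPolynomial (Fin 3) ℤ}
    {d : ℕ} (hd : s ∈ planeGrading d) {v : Fin 3 → R} (hs : IsUnit (MvPolynomial.aeval v s))
    (φ : Away₀ s →+* R)
    (h : ∀ n p hp, φ (.mk planeGrading hd n p hp) * MvPolynomial.aeval v s ^ n =
      MvPolynomial.aeval v p) : φ = awayEval v s hs := by
  ext x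
  obtain ⟨n, p, hp, rfl⟩ := HomogeneousLocalization.Away.mk_surjective planeGrading hd x
  exact (hs.pow n).mul_left_injective ((h n p hp).trans (awayEval_mk v hs hd n p hp).symm)

lemma X_mem (i : Fin 3) : (MvPolynomial.X i : MvPolynomial (Fin 3) ℤ) ∈ planeGrading 1 :=
  MvPolynomial.isHomogeneous_X ℤ i

/-- The standard chart `x_i ≠ 0` of the projective plane. -/
def planeChart (i : Fin 3) : Spec (CommRingCat.of (Away₀ (MvPolynomial.X i))) ⟶ plane :=
  Proj.awayι planeGrading (MvPolynomial.X i) (X_mem i) one_pos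

/-- The `Y`-point `[v₀ : v₁ : v₂]` of the projective plane, where `v_i` is invertible. -/
def homogPoint {Y : Scheme.{0}} (v : Fin 3 → Γ(Y, ⊤)) (i : Fin 3) (hi : IsUnit (v i)) :
    Y ⟶ plane :=
  ofSections (awayEval v (MvPolynomial.X i) (by simpa using hi)) ≫ planeChart i

lemma comp_homogPoint {Y Z : Scheme.{0}} (h : Z ⟶ Y) (v : Fin 3 → Γ(Y, ⊤)) (i : Fin 3)
    (hi : IsUnit (v i)) :
    h ≫ homogPoint v i hi =
      homogPoint (fun j => h.appTop.hom (v j)) i (hi.map h.appTop.hom) := by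
  unfold homogPoint
  rw [← Category.assoc]
  congr 1
  apply toSections_injective
  rw [toSections_comp, toSections_ofSections, toSections_ofSections]
  refine awayEval_ext (X_mem i) _ _ fun n p hp => ?_
  have := congrArg h.appTop.hom
    (awayEval_mk v (s := MvPolynomial.X i) (by simpa using hi) (X_mem i) n p hp)
  rw [map_mul, map_pow] at this
  rwa [map_aeval_int, map_aeval_int] at this

lemma aeval_smul {R : Type} [CommRing R] [Algebra ℤ R] (u : R) {v w : Fin 3 → R} (h : ∀ k, w k = u * v k)
    {n : ℕ} {p : MvPolynomial (Fin 3) ℤ} (hp : p ∈ planeGrading n) :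
    MvPolynomial.aeval w p = u ^ n * MvPolynomial.aeval v p := by
  rw [MvPolynomial.aeval_def, MvPolynomial.aeval_def, MvPolynomial.eval₂_eq, MvPolynomial.eval₂_eq,
    Finset.mul_sum]
  refine Finset.sum_congr rfl fun d hd => ?_
  have hn : ∏ k ∈ d.support, u ^ d k = u ^ n := by
    rw [Finset.prod_pow_eq_pow_sum]
    congr 1
    have := hp (MvPolynomial.mem_support_iff.mp hd)
    rw [← this, Finsupp.weight_apply]
    simp [Finsupp.sum]
  simp only [h, mul_pow, Finset.prod_mul_distrib, hn]
  ring

lemma homogPoint_eq_mul {Y : Scheme.{0}} (v : Fin 3 → Γ(Y, ⊤)) {i j : Fin 3} (hi : IsUnit (v i))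
    {t : MvPolynomial (Fin 3) ℤ} (ht : t = MvPolynomial.X i * MvPolynomial.X j)
    (h : IsUnit (MvPolynomial.aeval v t)) :
    homogPoint v i hi = ofSections (awayEval v t h) ≫
      Proj.awayι planeGrading t (ht ▸ SetLike.mul_mem_graded (X_mem i) (X_mem j)) two_pos := by
  rw [← Proj.SpecMap_awayMap_awayι planeGrading (X_mem i) one_pos (X_mem j) ht, ← Category.assoc]
  unfold homogPoint planeChart
  congr 1
  apply toSections_injective
  rw [toSections_map, toSections_ofSections, toSections_ofSections]
  symm
  refine awayEval_ext (X_mem i) _ _ fun n p hp => ?_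
  have hj : IsUnit (v j) := by
    rw [ht, map_mul, MvPolynomial.aeval_X, MvPolynomial.aeval_X] at h
    exact isUnit_of_mul_isUnit_right h
  rw [RingHom.comp_apply, HomogeneousLocalization.awayMap_mk]
  have := awayEval_mk v h (ht ▸ SetLike.mul_mem_graded (X_mem i) (X_mem j)) n
    (p * MvPolynomial.X j ^ n) (by
      rw [smul_add]
      exact SetLike.mul_mem_graded hp (SetLike.pow_mem_graded n (X_mem j)))
  apply (hj.pow n).mul_left_injective
  simp only [map_mul, map_pow, MvPolynomial.aeval_X] at this ⊢
  rw [← this, mul_assoc, ← mul_pow]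
  congr 2
  rw [ht]
  simp

lemma homogPoint_eq {Y : Scheme.{0}} {v w : Fin 3 → Γ(Y, ⊤)} {i j : Fin 3}
    (hi : IsUnit (v i)) (hj : IsUnit (w j)) (u : Γ(Y, ⊤)) (h : ∀ k, w k = u * v k) :
    homogPoint v i hi = homogPoint w j hj := by
  have hu : IsUnit u := by rw [h] at hj; exact isUnit_of_mul_isUnit_left hj
  have hj' : IsUnit (v j) := by rw [h] at hj; exact isUnit_of_mul_isUnit_right hj
  have hv : IsUnit (MvPolynomial.aeval v
      (MvPolynomial.X i * MvPolynomial.X j : MvPolynomial (Fin 3) ℤ)) := by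
    simpa using ⟨hi, hj'⟩
  have hdeg := SetLike.mul_mem_graded (X_mem i) (X_mem j)
  have hw : IsUnit (MvPolynomial.aeval w
      (MvPolynomial.X i * MvPolynomial.X j : MvPolynomial (Fin 3) ℤ)) := by
    rw [aeval_smul u h hdeg]
    exact (hu.pow _).mul hv
  rw [homogPoint_eq_mul v hi rfl hv, homogPoint_eq_mul w hj (mul_comm _ _) hw]
  congr 2
  refine awayEval_ext hdeg hw _ fun n p hp => ?_
  rw [aeval_smul u h hdeg, aeval_smul u h hp, ← awayEval_mk v hv hdeg n p hp, smul_eq_mul]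
  ring

/-- The coordinates `x_j / x_i` on the chart `x_i ≠ 0`. -/
def chartCoord (i j : Fin 3) : Away₀ (MvPolynomial.X i) :=
  .mk planeGrading (X_mem i) 1 (MvPolynomial.X j) (by simpa using X_mem j)

lemma chartCoord_self (i : Fin 3) : chartCoord i i = 1 := by
  ext
  simp [chartCoord]

lemma comp_planeChart {Y : Scheme.{0}} (i : Fin 3)
    (p : Y ⟶ Spec (CommRingCat.of (Away₀ (MvPolynomial.X i))))
    (hi : IsUnit (toSections p (chartCoord i i))) :
    p ≫ planeChart i = homogPoint (fun j => toSections p (chartCoord i j)) i hi := by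
  unfold homogPoint
  congr 1
  apply toSections_injective
  rw [toSections_ofSections]
  refine awayEval_ext (X_mem i) _ _ fun n P hP => ?_
  rw [smul_eq_mul, mul_one] at hP
  have key : HomogeneousLocalization.Away.mk planeGrading (X_mem i) n P (by simpa using hP) =
      MvPolynomial.aeval (chartCoord i) P := by
    apply HomogeneousLocalization.val_injective
    have h1 : (MvPolynomial.aeval (chartCoord i) P).val =
        MvPolynomial.aeval (fun j => (chartCoord i j).val) P :=
      map_aeval_int (algebraMap (Away₀ (MvPolynomial.X i)) (Localization.Away
        (MvPolynomial.X i : MvPolynomial (Fin 3) ℤ))) (chartCoord i) P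
    have h2 : MvPolynomial.aeval (fun j => algebraMap (MvPolynomial (Fin 3) ℤ)
        (Localization.Away (MvPolynomial.X i : MvPolynomial (Fin 3) ℤ)) (MvPolynomial.X j)) P =
        algebraMap (MvPolynomial (Fin 3) ℤ) _ P := by
      have := map_aeval_int (algebraMap (MvPolynomial (Fin 3) ℤ)
        (Localization.Away (MvPolynomial.X i : MvPolynomial (Fin 3) ℤ))) MvPolynomial.X P
      rw [MvPolynomial.aeval_X_left_apply] at this
      exact this.symm
    have h3 (j : Fin 3) : algebraMap (MvPolynomial (Fin 3) ℤ)
        (Localization.Away (MvPolynomial.X i : MvPolynomial (Fin 3) ℤ)) (MvPolynomial.X j) =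
        algebraMap (MvPolynomial (Fin 3) ℤ) _ (MvPolynomial.X i) * (chartCoord i j).val := by
      have := IsLocalization.mk'_spec
        (Localization.Away (MvPolynomial.X i : MvPolynomial (Fin 3) ℤ))
        (MvPolynomial.X j : MvPolynomial (Fin 3) ℤ)
        (⟨MvPolynomial.X i ^ 1, 1, rfl⟩ : Submonoid.powers (MvPolynomial.X i))
      simp only [chartCoord, HomogeneousLocalization.Away.val_mk, Localization.mk_eq_mk'_apply]
      rw [mul_comm]
      simp only [pow_one] at this ⊢
      exact this.symm
    rw [h1, HomogeneousLocalization.Away.val_mk, Localization.mk_eq_mk'_apply,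
      IsLocalization.mk'_eq_iff_eq_mul, ← h2, mul_comm, aeval_smul _ h3 hP, map_pow]
  rw [key, MvPolynomial.aeval_X, chartCoord_self, map_one, one_pow, mul_one]
  exact map_aeval_int (toSections p) (chartCoord i) P

lemma planeChart_overlap {Y : Scheme.{0}} (i j : Fin 3)
    (p : Y ⟶ Spec (CommRingCat.of (Away₀ (MvPolynomial.X i))))
    (q : Y ⟶ Spec (CommRingCat.of (Away₀ (MvPolynomial.X j))))
    (h : p ≫ planeChart i = q ≫ planeChart j) (k : Fin 3) :
    toSections q (chartCoord j k) =
      toSections q (chartCoord j i) * toSections p (chartCoord i k) := by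
  have e : (MvPolynomial.X i * MvPolynomial.X j : MvPolynomial (Fin 3) ℤ) =
    MvPolynomial.X i * MvPolynomial.X j := rfl
  let l : Y ⟶ Limits.pullback (Proj.awayι planeGrading (MvPolynomial.X i) (X_mem i) one_pos)
    (Proj.awayι planeGrading (MvPolynomial.X j) (X_mem j) one_pos) := Limits.pullback.lift p q h
  let r := l ≫ (Proj.pullbackAwayιIso planeGrading (X_mem i) one_pos (X_mem j) one_pos e).hom
  have hp : p = r ≫ Spec.map (CommRingCat.ofHom
      (HomogeneousLocalization.awayMap planeGrading (X_mem j) e)) := by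
    rw [show r = l ≫ _ from rfl, Category.assoc, Proj.pullbackAwayιIso_hom_SpecMap_awayMap_left]
    exact (Limits.pullback.lift_fst _ _ _).symm
  have hq : q = r ≫ Spec.map (CommRingCat.ofHom
      (HomogeneousLocalization.awayMap planeGrading (X_mem i) (e.trans (mul_comm _ _)))) := by
    rw [show r = l ≫ _ from rfl, Category.assoc, Proj.pullbackAwayιIso_hom_SpecMap_awayMap_right]
    exact (Limits.pullback.lift_snd _ _ _).symm
  rw [hp, hq, toSections_map, toSections_map]
  simp only [RingHom.comp_apply, ← map_mul]
  congr 1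
  apply HomogeneousLocalization.val_injective
  simp only [chartCoord, HomogeneousLocalization.awayMap_mk, HomogeneousLocalization.val_mul,
    HomogeneousLocalization.Away.val_mk, Localization.mk_mul]
  rw [Localization.mk_eq_mk_iff, Localization.r_iff_exists]
  refine ⟨1, ?_⟩
  simp
  ring

/-- The cover of the projective plane by its three standard charts. -/
def planeCover : plane.AffineOpenCover :=
  Proj.affineOpenCoverOfIrrelevantLESpan planeGrading
    (fun i : Fin 3 => (MvPolynomial.X i : MvPolynomial (Fin 3) ℤ)) (m := fun _ => 1) X_mem
    (fun _ => one_pos) (fun P hP => by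
      rw [← Set.image_univ]
      refine MvPolynomial.mem_ideal_span_X_image.mpr fun m hm => ?_
      by_contra! hc
      obtain rfl : m = 0 := Finsupp.ext fun i => hc i trivial
      have h0 : MvPolynomial.homogeneousComponent 0 P = 0 := by
        exact (MvPolynomial.decomposition.decompose'_apply P 0).symm.trans hP
      rw [MvPolynomial.homogeneousComponent_zero, MvPolynomial.C_eq_zero] at h0
      exact MvPolynomial.mem_support_iff.mp hm h0)

/-! ### The double scalar action on the projective plane -/

lemma isUnit_pointChar {M : Type} [AddCommGroup M] {Y : Scheme.{0}} (g : Y ⟶ diag M)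
    (m : Multiplicative M) : IsUnit (pointChar g m) :=
  (Group.isUnit m).map _

/-- The characters through which `D(ℤ²)` acts on the homogeneous coordinates:
`(λ, β) · [x : y : z] = [λ x : β y : z]`. -/
def weight : Fin 3 → ℤ × ℤ := ![(1, 0), (0, 1), (0, 0)]

/-- The cover of `D(ℤ²) × ℙ²` by the open subschemes `D(ℤ²) × {x_i ≠ 0}`. -/
def actCover : (diag (ℤ × ℤ) ⊗ plane).OpenCover :=
  planeCover.openCover.pullback₁ (snd (diag (ℤ × ℤ)) plane)

/-- The double scalar action, restricted to `D(ℤ²) × {x_i ≠ 0}`. -/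
def actChart (i : Fin 3) : Limits.pullback (snd (diag (ℤ × ℤ)) plane) (planeChart i) ⟶ plane :=
  homogPoint (fun j =>
    pointChar (Limits.pullback.fst (snd (diag (ℤ × ℤ)) plane) (planeChart i) ≫ fst _ _)
      (Multiplicative.ofAdd (weight j)) *
    toSections (Limits.pullback.snd (snd (diag (ℤ × ℤ)) plane) (planeChart i)) (chartCoord i j)) i
    (by
      rw [chartCoord_self, map_one, mul_one]
      exact isUnit_pointChar _ _)

lemma comp_actChart {Y : Scheme.{0}} (i : Fin 3)
    (p : Y ⟶ Limits.pullback (snd (diag (ℤ × ℤ)) plane) (planeChart i)) (g : Y ⟶ diag (ℤ × ℤ))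
    (q : Y ⟶ Spec (CommRingCat.of (Away₀ (MvPolynomial.X i))))
    (hg : p ≫ Limits.pullback.fst _ _ ≫ fst _ _ = g) (hq : p ≫ Limits.pullback.snd _ _ = q)
    (hi : IsUnit (pointChar g (Multiplicative.ofAdd (weight i)) * toSections q (chartCoord i i))) :
    p ≫ actChart i = homogPoint (fun j =>
      pointChar g (Multiplicative.ofAdd (weight j)) * toSections q (chartCoord i j)) i hi := by
  subst hg hq
  rw [actChart, comp_homogPoint]
  congr 1
  ext j
  rw [map_mul, pointChar_comp, toSections_comp]
  rfl

lemma isUnit_actCoord {Y : Scheme.{0}} (i : Fin 3) (g : Y ⟶ diag (ℤ × ℤ))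
    (q : Y ⟶ Spec (CommRingCat.of (Away₀ (MvPolynomial.X i)))) :
    IsUnit (pointChar g (Multiplicative.ofAdd (weight i)) * toSections q (chartCoord i i)) := by
  rw [chartCoord_self, map_one, mul_one]
  exact isUnit_pointChar _ _

lemma actChart_compat {Y : Scheme.{0}} (i j : Fin 3)
    (p : Y ⟶ Limits.pullback (snd (diag (ℤ × ℤ)) plane) (planeChart i))
    (q : Y ⟶ Limits.pullback (snd (diag (ℤ × ℤ)) plane) (planeChart j))
    (h : p ≫ Limits.pullback.fst _ _ = q ≫ Limits.pullback.fst _ _) :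
    p ≫ actChart i = q ≫ actChart j := by
  have hc : (p ≫ Limits.pullback.snd _ _) ≫ planeChart i =
      (q ≫ Limits.pullback.snd _ _) ≫ planeChart j := by
    rw [Category.assoc, Category.assoc, ← Limits.pullback.condition, ← Limits.pullback.condition,
      reassoc_of% h]
  have hg : q ≫ Limits.pullback.fst _ _ ≫ fst _ _ = p ≫ Limits.pullback.fst _ _ ≫ fst _ _ := by
    rw [reassoc_of% h]
  rw [comp_actChart i p _ _ rfl rfl (isUnit_actCoord _ _ _),
    comp_actChart j q _ _ hg rfl (isUnit_actCoord _ _ _)]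
  refine homogPoint_eq _ _ (toSections (q ≫ Limits.pullback.snd _ _) (chartCoord j i)) fun k => ?_
  rw [planeChart_overlap i j _ _ hc k]
  ring

/-- The action morphism `D(ℤ²) × ℙ² ⟶ ℙ²`, glued from its restrictions to the standard charts. -/
def planeAct : diag (ℤ × ℤ) ⊗ plane ⟶ plane :=
  Scheme.Cover.glueMorphisms actCover actChart fun i j =>
    actChart_compat i j _ _ Limits.pullback.condition

lemma fst_planeAct (i : Fin 3) :
    Limits.pullback.fst (snd (diag (ℤ × ℤ)) plane) (planeChart i) ≫ planeAct = actChart i :=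
  Scheme.Cover.ι_glueMorphisms actCover _ _ i

/-- In homogeneous coordinates, the action multiplies the coordinates by the characters. -/
lemma homogPoint_planeAct {Y : Scheme.{0}} (g : Y ⟶ diag (ℤ × ℤ)) (v : Fin 3 → Γ(Y, ⊤)) (i : Fin 3)
    (hi : IsUnit (v i)) :
    lift g (homogPoint v i hi) ≫ planeAct =
      homogPoint (fun j => pointChar g (Multiplicative.ofAdd (weight j)) * v j) i
        ((isUnit_pointChar _ _).mul hi) := by
  let q := ofSections (awayEval v (MvPolynomial.X i) (by simpa using hi))
  have hq : lift g (homogPoint v i hi) ≫ snd _ _ = q ≫ planeChart i := lift_snd _ _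
  obtain ⟨p, hp, hpq⟩ : ∃ p : Y ⟶ Limits.pullback (snd (diag (ℤ × ℤ)) plane) (planeChart i),
      p ≫ Limits.pullback.fst _ _ = lift g (homogPoint v i hi) ∧
      p ≫ Limits.pullback.snd _ _ = q :=
    ⟨Limits.pullback.lift _ q hq, Limits.pullback.lift_fst _ _ _, Limits.pullback.lift_snd _ _ _⟩
  have hpg : p ≫ Limits.pullback.fst _ _ ≫ fst _ _ = g := by
    rw [reassoc_of% hp, lift_fst]
  rw [← hp, Category.assoc, fst_planeAct, comp_actChart i p g q hpg hpq (isUnit_actCoord _ _ _)]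
  refine homogPoint_eq _ _ (v i) fun k => ?_
  have := awayEval_mk v (s := MvPolynomial.X i) (by simpa using hi) (X_mem i) 1 (MvPolynomial.X k)
    (by simpa using X_mem k)
  simp only [MvPolynomial.aeval_X, pow_one] at this
  rw [← this]
  simp only [q]
  rw [toSections_ofSections, chartCoord]
  ring

/-- Two morphisms from `Y` agree if they agree wherever `x` has homogeneous coordinates. -/
lemma hom_ext_of_homogPoint {Y Z : Scheme.{0}} (x : Y ⟶ plane) (f g : Y ⟶ Z)
    (h : ∀ (U : Scheme.{0}) (ι : U ⟶ Y) (v : Fin 3 → Γ(U, ⊤)) (i : Fin 3) (hi : IsUnit (v i)),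
      ι ≫ x = homogPoint v i hi → ι ≫ f = ι ≫ g) : f = g := by
  refine Scheme.Cover.hom_ext (planeCover.openCover.pullback₁ x) _ _ fun (i : Fin 3) => ?_
  have hi : IsUnit (toSections (Limits.pullback.snd x (planeChart i)) (chartCoord i i)) := by
    rw [chartCoord_self, map_one]
    exact isUnit_one
  exact h _ _ _ i hi (Limits.pullback.condition.trans (comp_planeChart i _ hi))

/-- The double scalar action `(λ, β) · [x : y : z] = [λ x : β y : z]` of `D(ℤ²)` on `ℙ²`. -/
def doubleScalarAction : DiagAction (ℤ × ℤ) plane where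
  act := planeAct
  one_act Y x := by
    refine hom_ext_of_homogPoint x _ _ fun U ι v i hi hx => ?_
    rw [comp_lift_assoc, comp_onePoint, hx, homogPoint_planeAct]
    refine (homogPoint_eq _ _ 1 fun k => ?_).symm
    rw [onePoint, pointChar_charPoint]
    rfl
  mul_act Y g h x := by
    refine hom_ext_of_homogPoint x _ _ fun U ι v i hi hx => ?_
    rw [comp_lift_assoc, comp_lift_assoc, comp_lift_assoc, hx, homogPoint_planeAct,
      homogPoint_planeAct, homogPoint_planeAct]
    refine homogPoint_eq _ _ 1 fun k => ?_
    rw [pointChar_comp, pointChar_comp, pointChar_comp, mulPoint, pointChar_charPoint]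
    simp [mul_assoc]

/-! ### The weights of the action on the charts -/

/-- The set `Φ` of the weights of the action on the standard charts. -/
def Φ : Finset (ℤ × ℤ) := {(1, 0), (0, 1), (1, -1), (0, -1), (-1, 1), (-1, 0)}

/-- A subset `E` of `Φ` is additively stable if `[E⟩ ∩ Φ = E`, where `[E⟩` is the submonoid of `ℤ²`
generated by `E`. -/
def IsAdditivelyStable (E : Finset (ℤ × ℤ)) : Prop :=
  E ⊆ Φ ∧ (AddSubmonoid.closure (E : Set (ℤ × ℤ)) : Set (ℤ × ℤ)) ∩ Φ = E

end Magnetism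

end

noncomputable section

namespace Magnetism

/-! ### Equality of points given by homogeneous coordinates -/

/-! In the chart `x_i ≠ 0` the coordinate `x_j / x_i` has weight `w_j - w_i`, which is `0` or an
element of `Φ`. The core of the proof is `mem_attractor_iff`: a `T`-point lies in `X^N` iff, locally
on `T`, it lies in some chart `x_i ≠ 0` where every coordinate of weight outside `N` vanishes.

Such a point extends along `A(N)` by multiplying each surviving coordinate by the character of its
weight; the extensions do not depend on the coordinates chosen (`twistPoint_congr`), so they glue.
Conversely, let `φ` be equivariant on `A(N) × T`. The idempotent `e` of `A(N)`, which is `1` on the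
units of `N` and `0` elsewhere, lies in the closure of every torus orbit. Charts are open and stable
under the torus, so a chart containing `φ(e, t)` contains the image of the whole fibre over `t`
(`inChart_of_inChart_facePoint`). Near `t` the map is then given by coordinates in `R[N]`, which
equivariance forces to be single monomials of weight `w_j - w_i`; those with weight outside `N` are
zero.

Hence `X^N` depends only on `N ∩ Φ`. It also determines `N ∩ Φ`, because a nilpotent tangent vector
at a fixed point detects each weight (`attractor_eq_iff`). So the pure magnets are the `[E⟩` with
`E` additively stable, and `[E⟩` is lambdafiable iff `E` is the trace on `Φ` of a closed half-plane,
the zero form included. Now `Φ` is a root system of type `A₂`. Its half-plane traces are 6 of size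
three, 6 of size four and `Φ` itself, 13 in all; the other stable subsets are the empty set, 6
singletons and the 9 pairs whose sum is not a root, 16 in all. -/

lemma awayEval_chartCoord {R : Type} [CommRing R] (v : Fin 3 → R) (i k : Fin 3)
    (hi : IsUnit (MvPolynomial.aeval v (MvPolynomial.X i : MvPolynomial (Fin 3) ℤ))) :
    awayEval v (MvPolynomial.X i) hi (chartCoord i k) * v i = v k := by
  have := awayEval_mk v hi (X_mem i) 1 (MvPolynomial.X k) (by simpa using X_mem k)
  rwa [MvPolynomial.aeval_X, MvPolynomial.aeval_X, pow_one] at this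

/-- Homogeneous coordinates of a point are unique up to scaling. -/
lemma exists_eq_mul_of_homogPoint_eq {Y : Scheme.{0}} {v w : Fin 3 → Γ(Y, ⊤)} {i j : Fin 3}
    {hi : IsUnit (v i)} {hj : IsUnit (w j)} (h : homogPoint v i hi = homogPoint w j hj) :
    ∃ u, ∀ k, w k = u * v k := by
  obtain ⟨b, hb⟩ := hi.exists_left_inv
  have key := planeChart_overlap i j _ _ h
  simp only [toSections_ofSections] at key
  -- This factor is `w i / v i`: the chart coordinate is `w i / w j`, and `b` is the inverse of `v
  -- i`.
  refine ⟨w j * awayEval w (MvPolynomial.X j) (by simpa using hj) (chartCoord j i) * b,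
    fun k => ?_⟩
  rw [← awayEval_chartCoord w j k (by simpa using hj), key,
    ← awayEval_chartCoord v i k (by simpa using hi)]
  linear_combination (-(awayEval w (MvPolynomial.X j) (by simpa using hj) (chartCoord j i)) *
    awayEval v (MvPolynomial.X i) (by simpa using hi) (chartCoord i k) * w j) * hb

/-! ### Extending a point along the orbit map -/

section

variable {N : AddSubmonoid (ℤ × ℤ)}

/-- The vector of the `χ(w_j - w_i) v_j`, extended by zero where `w_j - w_i` is not in `N`. -/
def twist {Y : Scheme.{0}} (i : Fin 3) (n : Y ⟶ diag N) (v : Fin 3 → Γ(Y, ⊤)) (j : Fin 3) :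
    Γ(Y, ⊤) :=
  open Classical in
  if h : weight j - weight i ∈ N then pointChar n (Multiplicative.ofAdd ⟨_, h⟩) * v j else 0

lemma twist_of_mem {Y : Scheme.{0}} {i j : Fin 3} (n : Y ⟶ diag N) (v : Fin 3 → Γ(Y, ⊤))
    (h : weight j - weight i ∈ N) :
    twist i n v j = pointChar n (Multiplicative.ofAdd ⟨_, h⟩) * v j := dif_pos h

lemma twist_of_notMem {Y : Scheme.{0}} {i j : Fin 3} (n : Y ⟶ diag N) (v : Fin 3 → Γ(Y, ⊤))
    (h : weight j - weight i ∉ N) : twist i n v j = 0 := dif_neg h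

lemma twist_self {Y : Scheme.{0}} (i : Fin 3) (n : Y ⟶ diag N) (v : Fin 3 → Γ(Y, ⊤)) :
    twist i n v i = v i := by
  have h : weight i - weight i ∈ N := by rw [sub_self]; exact zero_mem N
  rw [twist_of_mem n v h, show (⟨_, h⟩ : N) = 0 from Subtype.ext (sub_self _), ofAdd_zero, map_one,
    one_mul]

lemma appTop_twist {Y Z : Scheme.{0}} (h : Z ⟶ Y) (i j : Fin 3) (n : Y ⟶ diag N)
    (v : Fin 3 → Γ(Y, ⊤)) :
    h.appTop.hom (twist i n v j) = twist i (h ≫ n) (fun k => h.appTop.hom (v k)) j := by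
  by_cases hj : weight j - weight i ∈ N
  · rw [twist_of_mem _ _ hj, twist_of_mem _ _ hj, map_mul, pointChar_comp]
    rfl
  · rw [twist_of_notMem _ _ hj, twist_of_notMem _ _ hj, map_zero]

/-- The point `[χ(w_j - w_i) v_j]_j` of the projective plane. -/
def twistPoint {Y : Scheme.{0}} (n : Y ⟶ diag N) (v : Fin 3 → Γ(Y, ⊤)) (i : Fin 3)
    (hi : IsUnit (v i)) : Y ⟶ plane :=
  homogPoint (twist i n v) i ((twist_self i n v).symm ▸ hi)

lemma comp_twistPoint {Y Z : Scheme.{0}} (h : Z ⟶ Y) (n : Y ⟶ diag N) (v : Fin 3 → Γ(Y, ⊤))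
    (i : Fin 3) (hi : IsUnit (v i)) :
    h ≫ twistPoint n v i hi =
      twistPoint (h ≫ n) (fun j => h.appTop.hom (v j)) i (hi.map h.appTop.hom) := by
  unfold twistPoint
  rw [comp_homogPoint]
  exact homogPoint_eq _ _ 1 fun k => by rw [one_mul, appTop_twist]

/-- The vanishing condition is what makes the twist an extension of the original point: truncation
by zero then loses nothing. -/
lemma twistPoint_onePoint {Y : Scheme.{0}} (v : Fin 3 → Γ(Y, ⊤)) (i : Fin 3)
    (hi : IsUnit (v i)) (hv : ∀ j, weight j - weight i ∉ N → v j = 0) :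
    twistPoint (onePoint N Y) v i hi = homogPoint v i hi := by
  refine (homogPoint_eq _ _ 1 fun k => ?_).symm
  by_cases hk : weight k - weight i ∈ N
  · rw [twist_of_mem _ _ hk, onePoint, pointChar_charPoint]
    rfl
  · rw [twist_of_notMem _ _ hk, hv k hk, mul_zero]

lemma twistPoint_mulPoint {Y : Scheme.{0}} (g : Y ⟶ diag (ℤ × ℤ)) (n : Y ⟶ diag N)
    (v : Fin 3 → Γ(Y, ⊤)) (i : Fin 3) (hi : IsUnit (v i)) :
    twistPoint (mulPoint (restrictPoint N g) n) v i hi =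
      lift g (twistPoint n v i hi) ≫ planeAct := by
  unfold twistPoint
  rw [homogPoint_planeAct]
  -- The torus scales by `w_k`, the twist only by `w_k - w_i`; the discrepancy is the common factor
  -- `g(w_i)`.
  refine homogPoint_eq _ _ (pointChar g (Multiplicative.ofAdd (weight i))) fun k => ?_
  by_cases hk : weight k - weight i ∈ N
  · rw [twist_of_mem _ _ hk, twist_of_mem _ _ hk, mulPoint, restrictPoint, pointChar_charPoint,
      pointChar_charPoint]
    have : pointChar g (Multiplicative.ofAdd (weight k)) =
        pointChar g (Multiplicative.ofAdd (weight i)) *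
          pointChar g (Multiplicative.ofAdd (weight k - weight i)) := by
      rw [← map_mul, ← ofAdd_add, add_sub_cancel]
    rw [this, mul_assoc, ← mul_assoc _ _ (v k)]
    rfl
  · rw [twist_of_notMem _ _ hk, twist_of_notMem _ _ hk, mul_zero, mul_zero]

/-- If the point lies in both charts, then `v j` and `w i` are units, so the vanishing conditions
force both `w_j - w_i` and `w_i - w_j` into `N`. The character is therefore invertible on this
difference, and the two twists differ by a scalar. -/
lemma twistPoint_congr {Y : Scheme.{0}} (n : Y ⟶ diag N) {v w : Fin 3 → Γ(Y, ⊤)} {i j : Fin 3}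
    {hi : IsUnit (v i)} {hj : IsUnit (w j)} (h : homogPoint v i hi = homogPoint w j hj)
    (hv : ∀ k, weight k - weight i ∉ N → v k = 0) (hw : ∀ k, weight k - weight j ∉ N → w k = 0) :
    twistPoint n v i hi = twistPoint n w j hj := by
  obtain ⟨u, hu⟩ := exists_eq_mul_of_homogPoint_eq h
  -- Over the zero ring a unit may vanish, so this case is separated.
  rcases subsingleton_or_nontrivial Γ(Y, ⊤) with _ | _
  · exact homogPoint_eq _ _ 1 fun k => Subsingleton.elim _ _
  have hji : weight j - weight i ∈ N := by
    by_contra hc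
    rw [hu, hv j hc, mul_zero] at hj
    exact not_isUnit_zero hj
  have hij : weight i - weight j ∈ N := by
    by_contra hc
    have h1 := hw i hc
    have hu' : IsUnit u := isUnit_of_mul_isUnit_left (hu j ▸ hj)
    rw [hu] at h1
    exact (hu'.mul hi).ne_zero h1
  refine homogPoint_eq _ _ (pointChar n (Multiplicative.ofAdd ⟨_, hij⟩) * u) fun k => ?_
  by_cases hk : weight k - weight i ∈ N
  · have hk' : weight k - weight j ∈ N := by
      have := add_mem hk hij
      rwa [sub_add_sub_cancel] at this
    rw [twist_of_mem _ _ hk, twist_of_mem _ _ hk', hu,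
      show (⟨_, hk'⟩ : N) = ⟨_, hij⟩ + ⟨_, hk⟩ from Subtype.ext (by simp), ofAdd_add, map_mul]
    ring
  · have hk' : weight k - weight j ∉ N := fun hc => hk (by
      have := add_mem hc hji
      rwa [sub_add_sub_cancel] at this)
    rw [twist_of_notMem _ _ hk, twist_of_notMem _ _ hk', mul_zero]

/-! ### Gluing the extensions -/

/-- A point of the projective plane satisfies this condition if locally, in a chart `x_i ≠ 0`, its
coordinates of weight outside `N` vanish. -/
def IsLocallyIn (N : AddSubmonoid (ℤ × ℤ)) {T : Scheme.{0}} (x : T ⟶ plane) : Prop :=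
  ∀ t : T, ∃ (U : Scheme.{0}) (ι : U ⟶ T) (_ : IsOpenImmersion ι), t ∈ Set.range ι ∧
    ∃ (v : Fin 3 → Γ(U, ⊤)) (i : Fin 3) (hi : IsUnit (v i)), ι ≫ x = homogPoint v i hi ∧
      ∀ j, weight j - weight i ∉ N → v j = 0

/-- The morphism `(n, t) ↦ [χ(w_j - w_i) v_j]_j` on `A(N) × U`, for a morphism `U ⟶ T`. -/
def twistChart (N : AddSubmonoid (ℤ × ℤ)) {T U : Scheme.{0}} (ι : U ⟶ T) (v : Fin 3 → Γ(U, ⊤))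
    (i : Fin 3) (hi : IsUnit (v i)) : Limits.pullback (snd (diag N) T) ι ⟶ plane :=
  twistPoint (Limits.pullback.fst (snd (diag N) T) ι ≫ fst _ _)
    (fun j => (Limits.pullback.snd (snd (diag N) T) ι).appTop.hom (v j)) i (hi.map _)

lemma comp_twistChart {Y T U : Scheme.{0}} {ι : U ⟶ T} (v : Fin 3 → Γ(U, ⊤)) (i : Fin 3)
    (hi : IsUnit (v i)) (p : Y ⟶ Limits.pullback (snd (diag N) T) ι) (n : Y ⟶ diag N) (q : Y ⟶ U)
    (hn : p ≫ Limits.pullback.fst _ _ ≫ fst _ _ = n) (hq : p ≫ Limits.pullback.snd _ _ = q) :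
    p ≫ twistChart N ι v i hi =
      twistPoint n (fun j => q.appTop.hom (v j)) i (hi.map q.appTop.hom) := by
  subst hn hq
  rw [twistChart, comp_twistPoint]
  simp only [Scheme.Hom.comp_appTop, CommRingCat.hom_comp, RingHom.comp_apply]

lemma twistChart_compat {T U U' Y : Scheme.{0}} {x : T ⟶ plane} {ι : U ⟶ T} {ι' : U' ⟶ T}
    {v : Fin 3 → Γ(U, ⊤)} {v' : Fin 3 → Γ(U', ⊤)} {i i' : Fin 3} {hi : IsUnit (v i)}
    {hi' : IsUnit (v' i')} (hx : ι ≫ x = homogPoint v i hi) (hx' : ι' ≫ x = homogPoint v' i' hi')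
    (hv : ∀ k, weight k - weight i ∉ N → v k = 0) (hv' : ∀ k, weight k - weight i' ∉ N → v' k = 0)
    (p : Y ⟶ Limits.pullback (snd (diag N) T) ι) (q : Y ⟶ Limits.pullback (snd (diag N) T) ι')
    (h : p ≫ Limits.pullback.fst _ _ = q ≫ Limits.pullback.fst _ _) :
    p ≫ twistChart N ι v i hi = q ≫ twistChart N ι' v' i' hi' := by
  rw [comp_twistChart v i hi p _ _ rfl rfl, comp_twistChart v' i' hi' q _ _ rfl rfl,
    reassoc_of% h]
  refine twistPoint_congr _ ?_ (fun k hk => by rw [hv k hk, map_zero])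
    (fun k hk => by rw [hv' k hk, map_zero])
  rw [← comp_homogPoint _ v i hi, ← comp_homogPoint _ v' i' hi', ← hx, ← hx', Category.assoc,
    Category.assoc, ← Limits.pullback.condition_assoc, ← Limits.pullback.condition_assoc,
    reassoc_of% h]

lemma mem_attractor_of_isLocallyIn {T : Scheme.{0}} (x : T ⟶ plane) (hx : IsLocallyIn N x) :
    x ∈ (attractor doubleScalarAction N).obj (Opposite.op T) := by
  choose U ι hι hmem v i hi hxv hv using hx
  let 𝒰 : T.OpenCover :=
    { I₀ := T
      X := U
      f := ι
      mem₀ := by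
        rw [Scheme.presieve₀_mem_precoverage_iff]
        exact ⟨fun t => ⟨t, hmem t⟩, hι⟩ }
  let 𝒱 := 𝒰.pullback₁ (snd (diag N) T)
  let φ : diag N ⊗ T ⟶ plane := Scheme.Cover.glueMorphisms 𝒱
    (fun t => twistChart N (ι t) (v t) (i t) (hi t))
    fun s t => twistChart_compat (hxv s) (hxv t) (hv s) (hv t) _ _ Limits.pullback.condition
  -- The glued morphism on points over `U t`; equivariance and the value at the unit section both
  -- reduce to this formula.
  have hφ {Y : Scheme.{0}} (n : Y ⟶ diag N) (t : T) (p : Y ⟶ U t) :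
      lift n (p ≫ ι t) ≫ φ =
        twistPoint n (fun j => p.appTop.hom (v t j)) (i t) ((hi t).map p.appTop.hom) := by
    obtain ⟨r, hr, hrp⟩ : ∃ r : Y ⟶ Limits.pullback (snd (diag N) T) (ι t),
        r ≫ Limits.pullback.fst _ _ = lift n (p ≫ ι t) ∧ r ≫ Limits.pullback.snd _ _ = p :=
      ⟨Limits.pullback.lift _ p (lift_snd _ _), Limits.pullback.lift_fst _ _ _,
        Limits.pullback.lift_snd _ _ _⟩
    have h1 : Limits.pullback.fst (snd (diag N) T) (ι t) ≫ φ =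
        twistChart N (ι t) (v t) (i t) (hi t) := Scheme.Cover.ι_glueMorphisms 𝒱 _ _ t
    rw [← hr, Category.assoc, h1]
    exact comp_twistChart _ _ _ r n p (by rw [reassoc_of% hr, lift_fst]) hrp
  refine ⟨⟨φ, fun Y g n τ => ?_⟩, ?_⟩
  -- Equivariance is local on `Y`, and pulling back the cover of `T` brings it to points over some
  -- `U t`.
  · refine Scheme.Cover.hom_ext (𝒰.pullback₁ τ) _ _ fun (t : T) => ?_
    change Limits.pullback.fst τ (ι t) ≫ _ = Limits.pullback.fst τ (ι t) ≫ _
    rw [comp_lift_assoc, comp_lift_assoc, comp_lift_assoc, Limits.pullback.condition, hφ, hφ]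
    change _ = lift _ _ ≫ planeAct
    rw [← twistPoint_mulPoint]
    congr 1
    apply pointChar_injective
    rw [pointChar_comp]
    simp only [mulPoint, restrictPoint, pointChar_charPoint, pointChar_comp]
    ext m
    simp
  · change lift (onePoint N T) (𝟙 T) ≫ φ = x
    refine Scheme.Cover.hom_ext 𝒰 _ _ fun (t : T) => ?_
    change ι t ≫ _ = ι t ≫ _
    rw [comp_lift_assoc, comp_onePoint, Category.comp_id, ← Category.id_comp (ι t), hφ,
      twistPoint_onePoint, ← comp_homogPoint _ _ _ (hi t), ← hxv, Category.assoc]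
    intro j hj
    rw [hv t j hj, map_zero]

end

/-! ### Points of `A(N)` with values in a ring -/

/-- The `R`-point of `A(N)` of a monoid homomorphism `N → (R, ·)`. -/
def specPoint {N : Type} [AddCommMonoid N] {R : Type} [CommRing R] (c : Multiplicative N →* R) :
    Spec (CommRingCat.of R) ⟶ diag N :=
  charPoint (((Scheme.ΓSpecIso (CommRingCat.of R)).inv.hom :
    R →* Γ(Spec (CommRingCat.of R), ⊤)).comp c)

section

variable {N : Type} [AddCommMonoid N] {R S : Type} [CommRing R] [CommRing S]

lemma map_specPoint (f : R →+* S) (c : Multiplicative N →* R) :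
    Spec.map (CommRingCat.ofHom f) ≫ specPoint c = specPoint ((f : R →* S).comp c) := by
  apply pointChar_injective
  rw [pointChar_comp, specPoint, specPoint, pointChar_charPoint, pointChar_charPoint]
  ext n
  exact (congr($(Scheme.ΓSpecIso_inv_naturality (CommRingCat.ofHom f)).hom (c n))).symm

lemma exists_eq_specPoint (p : Spec (CommRingCat.of R) ⟶ diag N) : ∃ c, p = specPoint c := by
  refine ⟨((Scheme.ΓSpecIso (CommRingCat.of R)).hom.hom :
    Γ(Spec (CommRingCat.of R), ⊤) →* R).comp (pointChar p), pointChar_injective ?_⟩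
  rw [specPoint, pointChar_charPoint]
  ext n
  exact (congr($((Scheme.ΓSpecIso (CommRingCat.of R)).hom_inv_id).hom (pointChar p n))).symm

lemma mulPoint_specPoint (c d : Multiplicative N →* R) :
    mulPoint (specPoint c) (specPoint d) = specPoint (c * d) := by
  apply pointChar_injective
  simp only [mulPoint, specPoint, pointChar_charPoint]
  ext n
  simp

lemma onePoint_spec : onePoint N (Spec (CommRingCat.of R)) = specPoint 1 := by
  apply pointChar_injective
  simp only [onePoint, specPoint, pointChar_charPoint]
  ext n
  simp

end

/-- The restriction of a character to a submonoid. -/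
def restrictChar {M R : Type} [AddCommMonoid M] [CommRing R] (N : AddSubmonoid M)
    (c : Multiplicative M →* R) : Multiplicative N →* R :=
  c.comp (AddMonoidHom.toMultiplicative N.subtype)

lemma restrictPoint_specPoint {M R : Type} [AddCommMonoid M] [CommRing R] (N : AddSubmonoid M)
    (c : Multiplicative M →* R) :
    restrictPoint N (specPoint c) = specPoint (restrictChar N c) := by
  apply pointChar_injective
  simp only [restrictPoint, specPoint, pointChar_charPoint]
  rfl

/-! ### The idempotent point of the face of units -/

/-- The character with value `1` at the invertible elements of `N`, and `0` elsewhere. -/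
def faceChar (N R : Type) [AddCommMonoid N] [CommRing R] : Multiplicative N →* R where
  toFun n := open Classical in if IsUnit n then 1 else 0
  map_one' := if_pos isUnit_one
  map_mul' m n := by
    -- The units form a face: in a commutative monoid a product is a unit only if both factors are.
    by_cases hm : IsUnit m <;> by_cases hn : IsUnit n <;> simp [hm, hn, IsUnit.mul_iff]

lemma isUnit_of_faceChar_ne_zero {N R : Type} [AddCommMonoid N] [CommRing R] {n : Multiplicative N}
    (h : faceChar N R n ≠ 0) : IsUnit n := by
  by_contra hc
  exact h (if_neg hc)

lemma comp_faceChar {N R S : Type} [AddCommMonoid N] [CommRing R] [CommRing S] (f : R →+* S) :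
    (f : R →* S).comp (faceChar N R) = faceChar N S := by
  refine MonoidHom.ext fun n => ?_
  by_cases hn : IsUnit n <;> simp [faceChar, hn]

/-- The `Y`-point of `A(N)` of the character `faceChar`. -/
def facePoint (N : Type) [AddCommMonoid N] (Y : Scheme.{0}) : Y ⟶ diag N :=
  charPoint (faceChar N Γ(Y, ⊤))

lemma comp_facePoint (N : Type) [AddCommMonoid N] {Y Z : Scheme.{0}} (h : Z ⟶ Y) :
    h ≫ facePoint N Y = facePoint N Z := by
  apply pointChar_injective
  rw [pointChar_comp, facePoint, facePoint, pointChar_charPoint, pointChar_charPoint,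
    comp_faceChar]

lemma facePoint_spec (N R : Type) [AddCommMonoid N] [CommRing R] :
    facePoint N (Spec (CommRingCat.of R)) = specPoint (faceChar N R) := by
  rw [facePoint, specPoint, comp_faceChar]

/-! ### Points in a standard chart -/

instance (i : Fin 3) : IsOpenImmersion (planeChart i) :=
  Proj.instIsOpenImmersionAwayι planeGrading (MvPolynomial.X i) (X_mem i) one_pos

/-- A point of the projective plane is in the chart `x_i ≠ 0`. -/
def InChart (i : Fin 3) {Y : Scheme.{0}} (x : Y ⟶ plane) : Prop :=
  ∃ (v : Fin 3 → Γ(Y, ⊤)) (hi : IsUnit (v i)), x = homogPoint v i hi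

lemma inChart_iff {i : Fin 3} {Y : Scheme.{0}} {x : Y ⟶ plane} :
    InChart i x ↔ ∀ y : Y, x y ∈ (planeChart i).opensRange := by
  constructor
  · rintro ⟨v, hi, rfl⟩ y
    exact ⟨ofSections (awayEval v (MvPolynomial.X i) (by simpa using hi)) y, rfl⟩
  · intro h
    have hsub : Set.range x ⊆ Set.range (planeChart i) := by
      rintro _ ⟨y, rfl⟩
      exact h y
    have hi : IsUnit (toSections (IsOpenImmersion.lift (planeChart i) x hsub)
        (chartCoord i i)) := by
      rw [chartCoord_self, map_one]
      exact isUnit_one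
    refine ⟨fun j => toSections (IsOpenImmersion.lift (planeChart i) x hsub) (chartCoord i j), hi,
      ?_⟩
    rw [← comp_planeChart, IsOpenImmersion.lift_fac]

lemma exists_mem_opensRange_planeChart (p : plane) : ∃ i, p ∈ (planeChart i).opensRange :=
  planeCover.openCover.exists_eq p

lemma InChart.act {i : Fin 3} {Y : Scheme.{0}} {x : Y ⟶ plane} (h : InChart i x)
    (g : Y ⟶ diag (ℤ × ℤ)) : InChart i (lift g x ≫ planeAct) := by
  obtain ⟨v, hi, rfl⟩ := h
  exact ⟨_, _, homogPoint_planeAct g v i hi⟩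

/-- Charts are stable under the group, so it suffices to act by the inverse of `g`. -/
lemma InChart.of_act {i : Fin 3} {Y : Scheme.{0}} {x : Y ⟶ plane} {g : Y ⟶ diag (ℤ × ℤ)}
    (h : InChart i (lift g x ≫ planeAct)) : InChart i x := by
  let g' : Y ⟶ diag (ℤ × ℤ) := charPoint ((pointChar g).comp invMonoidHom)
  have hg : mulPoint g' g = onePoint _ Y := by
    apply pointChar_injective
    rw [mulPoint, pointChar_charPoint, pointChar_charPoint, onePoint, pointChar_charPoint]
    refine MonoidHom.ext fun m => ?_
    change pointChar g m⁻¹ * pointChar g m = 1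
    rw [← map_mul, inv_mul_cancel, map_one]
  have hx := doubleScalarAction.mul_act Y g' g x
  rw [hg, doubleScalarAction.one_act] at hx
  rw [hx]
  exact h.act g'

/-! ### Equivariant morphisms respect the charts -/

section

variable {N : AddSubmonoid (ℤ × ℤ)}

/-- The generic translate `n ↦ n χ(n)` of a character `χ` of `N`. -/
def genericChar {K : Type} [CommRing K] (c : Multiplicative N →* K) :
    Multiplicative N →* AddMonoidAlgebra K (ℤ × ℤ) :=
  restrictChar N (AddMonoidAlgebra.of K (ℤ × ℤ)) *
    (algebraMap K (AddMonoidAlgebra K (ℤ × ℤ)) : K →* AddMonoidAlgebra K (ℤ × ℤ)).comp c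

lemma genericChar_apply {K : Type} [CommRing K] (c : Multiplicative N →* K) (m : N) :
    genericChar c (Multiplicative.ofAdd m) =
      AddMonoidAlgebra.single (m : ℤ × ℤ) (c (Multiplicative.ofAdd m)) := by
  have : genericChar c (Multiplicative.ofAdd m) = AddMonoidAlgebra.single (m : ℤ × ℤ) 1 *
    AddMonoidAlgebra.single 0 (c (Multiplicative.ofAdd m)) := rfl
  rw [this, AddMonoidAlgebra.single_mul_single, add_zero, one_mul]

/-- Distinct elements of `N` go to distinct monomials, so nothing cancels when a function is
evaluated at a generic translate. -/
lemma coeff_lift_genericChar {K : Type} [CommRing K] (c : Multiplicative N →* K)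
    (f : AddMonoidAlgebra K N) (m : N) :
    (AddMonoidAlgebra.lift K (AddMonoidAlgebra K (ℤ × ℤ)) N (genericChar c) f).coeff m =
      f.coeff m * c (Multiplicative.ofAdd m) := by
  induction f using AddMonoidAlgebra.induction_linear with
  | zero => simp
  | add f g hf hg => rw [map_add, AddMonoidAlgebra.coeff_add, Finsupp.add_apply, hf, hg,
      AddMonoidAlgebra.coeff_add, Finsupp.add_apply, add_mul]
  | single a b =>
    rw [AddMonoidAlgebra.lift_single, genericChar_apply, AddMonoidAlgebra.smul_single,
      AddMonoidAlgebra.coeff_single, AddMonoidAlgebra.coeff_single]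
    by_cases h : a = m
    · subst h
      rw [Finsupp.single_eq_same, Finsupp.single_eq_same, smul_eq_mul]
    · rw [Finsupp.single_eq_of_ne (fun h' => h (Subtype.ext h'.symm)),
        Finsupp.single_eq_of_ne (Ne.symm h), zero_mul]

/-- A function that is nonzero at the idempotent has a nonzero coefficient at some unit `m` of `N`.
Every character `c` is invertible at `m`, so this coefficient survives at the generic translate of
`c`. Geometrically, every orbit meets every neighborhood of the idempotent. -/
lemma lift_genericChar_ne_zero {K : Type} [Field K] (c : Multiplicative N →* K)
    {f : AddMonoidAlgebra K N} (hf : AddMonoidAlgebra.lift K K N (faceChar N K) f ≠ 0) :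
    AddMonoidAlgebra.lift K (AddMonoidAlgebra K (ℤ × ℤ)) N (genericChar c) f ≠ 0 := by
  rw [AddMonoidAlgebra.lift_apply] at hf
  obtain ⟨m, -, hm⟩ := Finset.exists_ne_zero_of_sum_ne_zero hf
  have hu := isUnit_of_faceChar_ne_zero (right_ne_zero_of_smul hm)
  intro hc
  have := coeff_lift_genericChar c f m
  rw [hc] at this
  exact mul_ne_zero (left_ne_zero_of_smul hm) (hu.map c).ne_zero this.symm

lemma coeff_lift_genericChar_of_notMem {R : Type} [CommRing R] (c : Multiplicative N →* R)
    (f : AddMonoidAlgebra R N) {m : ℤ × ℤ} (hm : m ∉ N) :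
    (AddMonoidAlgebra.lift R (AddMonoidAlgebra R (ℤ × ℤ)) N (genericChar c) f).coeff m = 0 := by
  induction f using AddMonoidAlgebra.induction_linear with
  | zero => simp
  | add f g hf hg => rw [map_add, AddMonoidAlgebra.coeff_add, Finsupp.add_apply, hf, hg, add_zero]
  | single a b =>
    rw [AddMonoidAlgebra.lift_single, genericChar_apply, AddMonoidAlgebra.smul_single,
      AddMonoidAlgebra.coeff_single, Finsupp.single_eq_of_ne]
    rintro rfl
    exact hm a.2

lemma eq_zero_of_mem_asIdeal {K : Type} [Field K] (y : PrimeSpectrum K) {a : K}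
    (h : a ∈ y.asIdeal) : a = 0 := by
  by_contra ha
  exact y.2.ne_top (Ideal.eq_top_of_isUnit_mem _ h (IsUnit.mk0 a ha))

/-- An open neighborhood of a field-valued point contains the points outside of the vanishing locus
of some function that does not vanish at that point. -/
lemma exists_forall_mem_of_mem {A K : Type} [CommRing A] [Field K]
    {W : (Spec (CommRingCat.of A)).Opens} (ε : A →+* K) (y : Spec (CommRingCat.of K))
    (hy : Spec.map (CommRingCat.ofHom ε) y ∈ W) :
    ∃ f, ε f ≠ 0 ∧ ∀ (L : Type) [Field L] (γ : A →+* L), γ f ≠ 0 →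
      ∀ z : Spec (CommRingCat.of L), Spec.map (CommRingCat.ofHom γ) z ∈ W := by
  obtain ⟨_, ⟨f, rfl⟩, hf, hfW⟩ := TopologicalSpace.Opens.isBasis_iff_nbhd.mp
    (PrimeSpectrum.isBasis_basic_opens (R := A)) (U := W) hy
  refine ⟨f, fun h0 => hf ?_, fun L _ γ hγ z => hfW fun hc => hγ ?_⟩
  · change ε f ∈ PrimeSpectrum.asIdeal y
    rw [h0]
    exact zero_mem _
  · exact eq_zero_of_mem_asIdeal z hc

/-- The restriction of a morphism on `A(N) × T` to the `T`-point `t` and the universal point of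
`A(N)`. -/
def universalFiber {T X : Scheme.{0}} (φ : diag N ⊗ T ⟶ X) {R : Type} [CommRing R]
    (t : Spec (CommRingCat.of R) ⟶ T) : Spec (CommRingCat.of (AddMonoidAlgebra R N)) ⟶ X :=
  lift (specPoint (AddMonoidAlgebra.of R N))
    (Spec.map (CommRingCat.ofHom (algebraMap R (AddMonoidAlgebra R N))) ≫ t) ≫ φ

/-- The universal fibre specializes to every point of `A(N)` over `t`; the cases needed are the
idempotent, the unit section and generic translates. -/
lemma map_universalFiber {T X : Scheme.{0}} (φ : diag N ⊗ T ⟶ X) {R S : Type} [CommRing R]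
    [CommRing S] (t : Spec (CommRingCat.of R) ⟶ T) (j : R →+* S) (c : Multiplicative N →* S)
    (f : AddMonoidAlgebra R N →+* S) (hj : ∀ r, f (algebraMap R _ r) = j r)
    (hc : ∀ m, f (AddMonoidAlgebra.of R N m) = c m) :
    Spec.map (CommRingCat.ofHom f) ≫ universalFiber φ t =
      lift (specPoint c) (Spec.map (CommRingCat.ofHom j) ≫ t) ≫ φ := by
  obtain rfl : f.comp (algebraMap R _) = j := RingHom.ext hj
  obtain rfl : (f : AddMonoidAlgebra R N →* S).comp (AddMonoidAlgebra.of R N) = c :=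
    MonoidHom.ext hc
  rw [universalFiber, comp_lift_assoc, map_specPoint, ← Category.assoc, ← Spec.map_comp,
    ← CommRingCat.ofHom_comp]

/-- Equivariance for the universal point of the torus. The map `j` leaves room to pass to a fraction
field. -/
lemma lift_genericPoint_comp {T : Scheme.{0}} {φ : diag N ⊗ T ⟶ plane}
    (hφ : IsEquivariant doubleScalarAction N φ) {R S : Type} [CommRing R] [CommRing S]
    (t : Spec (CommRingCat.of R) ⟶ T) (c : Multiplicative N →* R)
    (j : AddMonoidAlgebra R (ℤ × ℤ) →+* S) :
    lift (specPoint ((j : AddMonoidAlgebra R (ℤ × ℤ) →* S).comp (genericChar c)))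
        (Spec.map (CommRingCat.ofHom (j.comp (algebraMap R _))) ≫ t) ≫ φ =
      lift (specPoint ((j : AddMonoidAlgebra R (ℤ × ℤ) →* S).comp
          (AddMonoidAlgebra.of R (ℤ × ℤ))))
        (Spec.map (CommRingCat.ofHom (j.comp (algebraMap R _))) ≫ lift (specPoint c) t ≫ φ) ≫
          planeAct := by
  have h := hφ _ (specPoint ((j : AddMonoidAlgebra R (ℤ × ℤ) →* S).comp
    (AddMonoidAlgebra.of R (ℤ × ℤ))))
    (Spec.map (CommRingCat.ofHom (j.comp (algebraMap R _))) ≫ specPoint c)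
    (Spec.map (CommRingCat.ofHom (j.comp (algebraMap R _))) ≫ t)
  rw [map_specPoint, restrictPoint_specPoint, mulPoint_specPoint] at h
  rw [comp_lift_assoc, map_specPoint]
  refine Eq.trans ?_ h
  congr 3
  refine MonoidHom.ext fun m => ?_
  exact map_mul j _ _

/-- If an equivariant morphism maps the idempotent point over a field-valued point `t` to a chart,
then it maps all points over `t` to that chart. -/
lemma inChart_of_inChart_facePoint {T : Scheme.{0}} {φ : diag N ⊗ T ⟶ plane}
    (hφ : IsEquivariant doubleScalarAction N φ) {i : Fin 3} {K : Type} [Field K]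
    (t : Spec (CommRingCat.of K) ⟶ T) (h : InChart i (lift (facePoint N _) t ≫ φ))
    (n : Spec (CommRingCat.of K) ⟶ diag N) : InChart i (lift n t ≫ φ) := by
  obtain ⟨c, rfl⟩ := exists_eq_specPoint n
  have hε := map_universalFiber φ t (RingHom.id K) (faceChar N K)
    (AddMonoidAlgebra.lift K K N (faceChar N K)).toRingHom
    (fun r => (AddMonoidAlgebra.lift K K N (faceChar N K)).commutes r)
    (fun m => AddMonoidAlgebra.lift_of _ m)
  rw [CommRingCat.ofHom_id, Spec.map_id, Category.id_comp, ← facePoint_spec] at hε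
  obtain ⟨y⟩ : Nonempty (Spec (CommRingCat.of K)) := ⟨(default : PrimeSpectrum K)⟩
  have hy := inChart_iff.mp (hε.symm ▸ h) y
  obtain ⟨f, hf, hfL⟩ := exists_forall_mem_of_mem
    (W := universalFiber φ t ⁻¹ᵁ (planeChart i).opensRange)
    (AddMonoidAlgebra.lift K K N (faceChar N K)).toRingHom y hy
  have hγ := lift_genericChar_ne_zero c hf
  -- In the fraction field a nonzero element is invertible, so the generic translate avoids the zero
  -- locus of `f`.
  let j := algebraMap (AddMonoidAlgebra K (ℤ × ℤ)) (FractionRing (AddMonoidAlgebra K (ℤ × ℤ)))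
  have hj : Function.Injective j := IsFractionRing.injective _ _
  have hL := map_universalFiber φ t (j.comp (algebraMap K _)) ((j : _ →* _).comp (genericChar c))
    (j.comp (AddMonoidAlgebra.lift K _ N (genericChar c)).toRingHom)
    (fun r => congrArg j ((AddMonoidAlgebra.lift K _ N (genericChar c)).commutes r))
    (fun m => congrArg j (AddMonoidAlgebra.lift_of _ m))
  rw [lift_genericPoint_comp hφ] at hL
  have hin : InChart i (Spec.map (CommRingCat.ofHom (j.comp
      (AddMonoidAlgebra.lift K _ N (genericChar c)).toRingHom)) ≫ universalFiber φ t) :=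
    inChart_iff.mpr fun z => hfL _ _ (fun h0 => hγ (hj (h0.trans (map_zero j).symm))) z
  rw [hL] at hin
  obtain ⟨z⟩ : Nonempty (Spec (CommRingCat.of (FractionRing (AddMonoidAlgebra K (ℤ × ℤ))))) :=
    ⟨(default : PrimeSpectrum _)⟩
  refine inChart_iff.mpr fun y => ?_
  -- `Spec K` has one point, so membership in the chart can be read off after the field extension.
  obtain rfl : y = Spec.map (CommRingCat.ofHom (j.comp (algebraMap K _))) z :=
    Subsingleton.elim (α := PrimeSpectrum K) _ _
  exact inChart_iff.mp hin.of_act z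

/-- The neighborhood is cut out by the idempotent alone, where `φ(e, ·)` stays in the chart. The
other points of `A(N)` follow by testing at residue fields. -/
lemma exists_affine_nhd_inChart {T : Scheme.{0}} {φ : diag N ⊗ T ⟶ plane}
    (hφ : IsEquivariant doubleScalarAction N φ) (t : T) :
    ∃ (R : CommRingCat.{0}) (ι : Spec R ⟶ T) (_ : IsOpenImmersion ι), t ∈ Set.range ι ∧
      ∃ i, ∀ (Y : Scheme.{0}) (n : Y ⟶ diag N) (p : Y ⟶ Spec R),
        InChart i (lift n (p ≫ ι) ≫ φ) := by
  obtain ⟨i, hi⟩ := exists_mem_opensRange_planeChart ((lift (facePoint N T) (𝟙 T) ≫ φ) t)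
  obtain ⟨U, hU, htU, hUW⟩ := exists_isAffineOpen_mem_and_subset
    (U := (lift (facePoint N T) (𝟙 T) ≫ φ) ⁻¹ᵁ (planeChart i).opensRange) hi
  refine ⟨_, hU.fromSpec, inferInstance, by rwa [hU.range_fromSpec], i, fun Y n p => ?_⟩
  refine inChart_iff.mpr fun y => ?_
  let s : Spec (CommRingCat.of (Y.residueField y)) ⟶ Y := Y.fromSpecResidueField y
  have key := inChart_of_inChart_facePoint hφ (i := i) (s ≫ p ≫ hU.fromSpec) (by
    have h : lift (facePoint N _) (s ≫ p ≫ hU.fromSpec) ≫ φ =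
        (s ≫ p ≫ hU.fromSpec) ≫ lift (facePoint N T) (𝟙 T) ≫ φ := by
      rw [comp_lift_assoc, comp_facePoint, Category.comp_id]
    rw [h]
    refine inChart_iff.mpr fun z => hUW ?_
    have : hU.fromSpec ((s ≫ p) z) ∈ Set.range hU.fromSpec := ⟨_, rfl⟩
    rwa [hU.range_fromSpec] at this) (s ≫ n)
  rw [← comp_lift_assoc] at key
  obtain ⟨z, hz⟩ : y ∈ Set.range (Y.fromSpecResidueField y) := by
    rw [Scheme.range_fromSpecResidueField]; rfl
  have := inChart_iff.mp key z
  rw [← hz]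
  exact this

/-! ### Homogeneous coordinates in a ring -/

section

variable {R S : Type} [CommRing R] [CommRing S]

/-- The `R`-point `[a₀ : a₁ : a₂]` of the projective plane, where `a_i` is invertible. -/
def specHomog (a : Fin 3 → R) (i : Fin 3) (hi : IsUnit (a i)) : Spec (CommRingCat.of R) ⟶ plane :=
  homogPoint (fun j => (Scheme.ΓSpecIso (CommRingCat.of R)).inv.hom (a j)) i (hi.map _)

lemma map_specHomog (f : R →+* S) (a : Fin 3 → R) (i : Fin 3) (hi : IsUnit (a i)) :
    Spec.map (CommRingCat.ofHom f) ≫ specHomog a i hi =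
      specHomog (fun j => f (a j)) i (hi.map f) := by
  rw [specHomog, comp_homogPoint]
  refine homogPoint_eq _ _ 1 fun k => ?_
  rw [one_mul]
  exact congr($(Scheme.ΓSpecIso_inv_naturality (CommRingCat.ofHom f)).hom (a k))

lemma homogPoint_eq_specHomog (v : Fin 3 → Γ(Spec (CommRingCat.of R), ⊤)) (i : Fin 3)
    (hi : IsUnit (v i)) :
    homogPoint v i hi =
      specHomog (fun j => (Scheme.ΓSpecIso (CommRingCat.of R)).hom.hom (v j)) i (hi.map _) := by
  refine homogPoint_eq _ _ 1 fun k => ?_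
  rw [one_mul]
  exact congr($((Scheme.ΓSpecIso (CommRingCat.of R)).hom_inv_id).hom (v k))

lemma exists_eq_mul_of_specHomog_eq {a b : Fin 3 → R} {i j : Fin 3} {hi : IsUnit (a i)}
    {hj : IsUnit (b j)} (h : specHomog a i hi = specHomog b j hj) : ∃ u, ∀ k, b k = u * a k := by
  obtain ⟨u, hu⟩ := exists_eq_mul_of_homogPoint_eq h
  have hid (r : R) : (Scheme.ΓSpecIso (CommRingCat.of R)).hom.hom
      ((Scheme.ΓSpecIso (CommRingCat.of R)).inv.hom r) = r :=
    congr($((Scheme.ΓSpecIso (CommRingCat.of R)).inv_hom_id).hom r)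
  refine ⟨(Scheme.ΓSpecIso (CommRingCat.of R)).hom.hom u, fun k => ?_⟩
  have := congrArg (Scheme.ΓSpecIso (CommRingCat.of R)).hom.hom (hu k)
  rwa [map_mul, hid, hid] at this

lemma specHomog_congr {a b : Fin 3 → R} {i : Fin 3} {hi : IsUnit (a i)}
    {hi' : IsUnit (b i)} (u : R) (h : ∀ k, b k = u * a k) : specHomog a i hi = specHomog b i hi' :=
  homogPoint_eq _ _ ((Scheme.ΓSpecIso (CommRingCat.of R)).inv.hom u) fun k => by
    rw [h, map_mul]

lemma InChart.exists_eq_specHomog {x : Spec (CommRingCat.of R) ⟶ plane} {i : Fin 3}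
    (h : InChart i x) : ∃ (a : Fin 3 → R) (ha : a i = 1), x = specHomog a i (ha ▸ isUnit_one) := by
  obtain ⟨v, hi, rfl⟩ := h
  rw [homogPoint_eq_specHomog]
  obtain ⟨b, hb⟩ := (hi.map (Scheme.ΓSpecIso (CommRingCat.of R)).hom.hom).exists_left_inv
  exact ⟨fun j => b * (Scheme.ΓSpecIso (CommRingCat.of R)).hom.hom (v j), hb,
    specHomog_congr b fun k => rfl⟩

lemma specHomog_planeAct (c : Multiplicative (ℤ × ℤ) →* R) (a : Fin 3 → R) (i : Fin 3)
    (hi : IsUnit (a i)) :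
    lift (specPoint c) (specHomog a i hi) ≫ planeAct =
      specHomog (fun j => c (Multiplicative.ofAdd (weight j)) * a j) i
        (((Group.isUnit (Multiplicative.ofAdd (weight i))).map c).mul hi) := by
  rw [specHomog, homogPoint_planeAct]
  refine homogPoint_eq _ _ 1 fun k => ?_
  rw [one_mul, specPoint, pointChar_charPoint, map_mul]
  rfl

end

/-! ### Local description of the attractors -/

/-- Coordinates of weight outside `N` vanish at the unit section. -/
lemma exists_coord_onePoint {T : Scheme.{0}} {φ : diag N ⊗ T ⟶ plane}
    (hφ : IsEquivariant doubleScalarAction N φ) {R : Type} [CommRing R]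
    (ι : Spec (CommRingCat.of R) ⟶ T) {i : Fin 3} (h : InChart i (universalFiber φ ι)) :
    ∃ (a : Fin 3 → R) (hi : IsUnit (a i)), lift (onePoint N _) ι ≫ φ = specHomog a i hi ∧
      ∀ j, weight j - weight i ∉ N → a j = 0 := by
  obtain ⟨a, ha, hfib⟩ := h.exists_eq_specHomog
  let ε : AddMonoidAlgebra R N →+* R := (AddMonoidAlgebra.lift R R N 1).toRingHom
  -- `γ` is the inclusion `R[N] → R[ℤ²]`, the generic translate of the unit section, at which `ε`
  -- evaluates.
  let γ : AddMonoidAlgebra R N →+* AddMonoidAlgebra R (ℤ × ℤ) :=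
    (AddMonoidAlgebra.lift R _ N (genericChar 1)).toRingHom
  have hε := map_universalFiber φ ι (RingHom.id R) 1 ε
    (fun r => (AddMonoidAlgebra.lift R R N 1).commutes r) (fun m => AddMonoidAlgebra.lift_of _ m)
  rw [CommRingCat.ofHom_id, Spec.map_id, Category.id_comp, ← onePoint_spec, hfib,
    map_specHomog] at hε
  refine ⟨_, _, hε.symm, fun j hj => ?_⟩
  have hγ := map_universalFiber φ ι (algebraMap R _) (genericChar 1) γ
    (fun r => (AddMonoidAlgebra.lift R _ N (genericChar 1)).commutes r)
    (fun m => AddMonoidAlgebra.lift_of _ m)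
  have hact := lift_genericPoint_comp hφ ι (1 : Multiplicative N →* R) (RingHom.id _)
  rw [← onePoint_spec, ← hε] at hact
  change lift (specPoint (genericChar 1)) (Spec.map (CommRingCat.ofHom (algebraMap R _)) ≫ ι) ≫ φ =
    lift (specPoint (AddMonoidAlgebra.of R (ℤ × ℤ)))
      (Spec.map (CommRingCat.ofHom (algebraMap R _)) ≫ _) ≫ planeAct at hact
  rw [← hγ, hfib, map_specHomog, map_specHomog, specHomog_planeAct] at hact
  obtain ⟨u, hu⟩ := exists_eq_mul_of_specHomog_eq hact
  -- Since `a i = 1`, the scalar `u` is the monomial of weight `w_i`.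
  have hui := hu i
  simp only [ha, map_one, mul_one] at hui
  have huj := hu j
  rw [← hui] at huj
  -- The coordinate is a single monomial with coefficient its value at the unit section. As `γ (a
  -- j)` is supported in `N`, that value is zero when the weight is not in `N`.
  have hcoeff : γ (a j) = AddMonoidAlgebra.single (weight j - weight i) (ε (a j)) := by
    have h1 : AddMonoidAlgebra.single (-weight i) (1 : R) *
        AddMonoidAlgebra.single (weight i) (1 : R) = 1 := by
      rw [AddMonoidAlgebra.single_mul_single, neg_add_cancel, one_mul]; rfl
    have h2 : AddMonoidAlgebra.single (weight j) (1 : R) *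
        AddMonoidAlgebra.single 0 (ε (a j)) =
        AddMonoidAlgebra.single (weight i) (1 : R) * γ (a j) := huj
    rw [← one_mul (γ (a j)), ← h1, mul_assoc, ← h2, AddMonoidAlgebra.single_mul_single,
      AddMonoidAlgebra.single_mul_single]
    congr 1
    · abel
    · rw [one_mul, one_mul]
  have := coeff_lift_genericChar_of_notMem (1 : Multiplicative N →* R) (a j) hj
  change (γ (a j)).coeff _ = 0 at this
  rwa [hcoeff, AddMonoidAlgebra.coeff_single, Finsupp.single_eq_same] at this

lemma isLocallyIn_of_mem_attractor {T : Scheme.{0}} {x : T ⟶ plane}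
    (hx : x ∈ (attractor doubleScalarAction N).obj (Opposite.op T)) : IsLocallyIn N x := by
  obtain ⟨⟨φ, hφ⟩, rfl⟩ := hx
  intro t
  obtain ⟨R, ι, hι, ht, i, hi⟩ := exists_affine_nhd_inChart hφ t
  obtain ⟨a, hai, hax, haj⟩ := exists_coord_onePoint hφ (R := R) ι (hi _ _ _)
  refine ⟨Spec R, ι, hι, ht, fun j => (Scheme.ΓSpecIso R).inv.hom (a j), i, hai.map _, ?_,
    fun j hj => ?_⟩
  · change ι ≫ lift (onePoint N T) (𝟙 T) ≫ φ = _
    rw [comp_lift_assoc, comp_onePoint, Category.comp_id]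
    exact hax
  · simp only [haj j hj, map_zero]

lemma mem_attractor_iff {T : Scheme.{0}} {x : T ⟶ plane} :
    x ∈ (attractor doubleScalarAction N).obj (Opposite.op T) ↔ IsLocallyIn N x :=
  ⟨isLocallyIn_of_mem_attractor, mem_attractor_of_isLocallyIn x⟩

/-! ### Attractors and weights -/

lemma weight_sub_mem : ∀ i j, weight j - weight i = 0 ∨ weight j - weight i ∈ Φ := by decide

lemma exists_weight_sub_eq : ∀ w ∈ Φ, ∃ i j, i ≠ j ∧ weight j - weight i = w := by decide

lemma IsLocallyIn.mono {N' : AddSubmonoid (ℤ × ℤ)} (h : ∀ w ∈ Φ, w ∈ N → w ∈ N') {T : Scheme.{0}}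
    {x : T ⟶ plane} (hx : IsLocallyIn N x) : IsLocallyIn N' x := by
  intro t
  obtain ⟨U, ι, hι, ht, v, i, hi, hxv, hv⟩ := hx t
  refine ⟨U, ι, hι, ht, v, i, hi, hxv, fun j hj => hv j fun hj' => hj ?_⟩
  rcases weight_sub_mem i j with h0 | hΦ
  · rw [h0]
    exact zero_mem N'
  · exact h _ hΦ hj'

/-- An open subscheme containing the only point is everything, so local coordinates are global. -/
lemma IsLocallyIn.exists_eq_specHomog {R : Type} [CommRing R] [Nontrivial R]
    [Subsingleton (PrimeSpectrum R)] {x : Spec (CommRingCat.of R) ⟶ plane} (h : IsLocallyIn N x) :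
    ∃ (a : Fin 3 → R) (i : Fin 3) (hi : IsUnit (a i)), x = specHomog a i hi ∧
      ∀ j, weight j - weight i ∉ N → a j = 0 := by
  obtain ⟨U, ι, hι, ⟨u, hu⟩, v, i, hi, hxv, hv⟩ := h (Classical.arbitrary (PrimeSpectrum R))
  have hsub : Set.range (𝟙 (Spec (CommRingCat.of R))) ⊆ Set.range ι := fun y _ =>
    ⟨u, Subsingleton.elim (α := PrimeSpectrum R) _ _⟩
  obtain ⟨s, hs⟩ : ∃ s, s ≫ ι = 𝟙 (Spec (CommRingCat.of R)) :=
    ⟨_, IsOpenImmersion.lift_fac ι (𝟙 (Spec (CommRingCat.of R))) hsub⟩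
  refine ⟨fun j => (Scheme.ΓSpecIso (CommRingCat.of R)).hom.hom (s.appTop.hom (v j)), i,
    (hi.map _).map _, ?_, fun j hj => ?_⟩
  · rw [← Category.id_comp x, ← hs, Category.assoc, hxv, comp_homogPoint, homogPoint_eq_specHomog]
  · simp only [hv j hj, map_zero]

instance : Subsingleton (PrimeSpectrum (ZMod 4)) where
  allEq p q := by
    have key (p : PrimeSpectrum (ZMod 4)) (x : ZMod 4) : x ∈ p.asIdeal ↔ x * x = 0 := by
      refine ⟨fun h => ?_, fun h => (p.2.mem_or_mem (h ▸ zero_mem _)).elim id id⟩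
      -- Hence a prime ideal consists exactly of the elements of square zero.
      have hx : ∀ x : ZMod 4, x * x = 0 ∨ x * x = 1 := by decide
      refine (hx x).resolve_right fun h1 => p.2.ne_top ?_
      rw [Ideal.eq_top_iff_one, ← h1]
      exact Ideal.mul_mem_left _ _ h
    ext x
    rw [key, key]

/-- The vector with `x_i = 1`, `x_j = 2` and third coordinate zero. -/
def tangentVector (i j : Fin 3) (k : Fin 3) : ZMod 4 := if k = i then 1 else if k = j then 2 else 0

lemma isUnit_tangentVector (i j : Fin 3) : IsUnit (tangentVector i j i) := by
  rw [tangentVector, if_pos rfl]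
  exact isUnit_one

/-- This is why the test ring is not a field: `2` is nonzero but not a unit, so the point has a
nonzero coordinate `x_j` without lying in the chart `x_j ≠ 0`, where only the opposite weight would
be tested. -/
lemma eq_of_isUnit_tangentVector {i j k : Fin 3} (h : IsUnit (tangentVector i j k)) : k = i := by
  by_contra hk
  obtain ⟨b, hb⟩ := h.exists_left_inv
  rw [tangentVector, if_neg hk] at hb
  split_ifs at hb
  · revert b; decide
  · revert b; decide

/-- The point `x_i = 1`, `x_j = 2` over `ℤ / 4`, a tangent vector at a fixed point, detects the
weight `w_j - w_i`. -/
lemma isLocallyIn_tangentVector_iff {i j : Fin 3} (hij : i ≠ j) :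
    IsLocallyIn N (specHomog (tangentVector i j) i (isUnit_tangentVector i j)) ↔
      weight j - weight i ∈ N := by
  refine ⟨fun h => ?_, fun h t => ?_⟩
  · have : Nontrivial (ZMod 4) := ⟨0, 1, by decide⟩
    obtain ⟨a, k, hk, hx, ha⟩ := h.exists_eq_specHomog
    obtain ⟨u, hu⟩ := exists_eq_mul_of_specHomog_eq hx
    rw [hu] at hk
    obtain rfl := eq_of_isUnit_tangentVector (isUnit_of_mul_isUnit_right hk)
    by_contra hc
    have h0 := ha j hc
    have hu' := isUnit_of_mul_isUnit_left hk
    rw [hu, hu'.mul_right_eq_zero, tangentVector, if_neg hij.symm, if_pos rfl] at h0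
    revert h0; decide
  · refine ⟨_, 𝟙 _, inferInstance, ⟨t, rfl⟩, _, i, _, Category.id_comp _, fun k hk => ?_⟩
    have h0 : tangentVector i j k = 0 := by
      rw [tangentVector, if_neg, if_neg]
      · rintro rfl
        exact hk h
      · rintro rfl
        exact hk (by rw [sub_self]; exact zero_mem N)
    rw [h0, map_zero]

lemma attractor_eq_iff {N N' : AddSubmonoid (ℤ × ℤ)} :
    attractor doubleScalarAction N = attractor doubleScalarAction N' ↔
      ∀ w ∈ Φ, w ∈ N ↔ w ∈ N' := by
  refine ⟨fun h w hw => ?_, fun h => ?_⟩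
  · obtain ⟨i, j, hij, rfl⟩ := exists_weight_sub_eq w hw
    rw [← isLocallyIn_tangentVector_iff hij, ← isLocallyIn_tangentVector_iff hij,
      ← mem_attractor_iff, ← mem_attractor_iff, h]
  · ext T x
    exact mem_attractor_iff.trans ((Iff.intro (IsLocallyIn.mono fun w hw => (h w hw).mp)
      (IsLocallyIn.mono fun w hw => (h w hw).mpr)).trans mem_attractor_iff.symm)

end

/-! ### Sum-closed subsets of the set of weights -/

/-- A subset of `Φ` is sum-closed if it contains every sum of two of its elements that lies in
`Φ`. -/
def IsSumClosed (E : Finset (ℤ × ℤ)) : Prop :=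
  E ⊆ Φ ∧ ∀ x ∈ E, ∀ y ∈ E, x + y ∈ Φ → x + y ∈ E

instance (E : Finset (ℤ × ℤ)) : Decidable (IsSumClosed E) := by
  unfold IsSumClosed; infer_instance

/-- The linear forms with coefficients between `-2` and `2`. -/
def smallForms : Finset (ℤ × ℤ) := Finset.Icc (-2) 2 ×ˢ Finset.Icc (-2) 2

/-- Such a form certifies that `w` is not in the monoid generated by `E`. -/
lemma exists_smallForm_separating : ∀ E ∈ Φ.powerset, IsSumClosed E → ∀ w ∈ Φ, w ∉ E →
    ∃ c ∈ smallForms, (∀ x ∈ E, 0 ≤ c.1 * x.1 + c.2 * x.2) ∧ c.1 * w.1 + c.2 * w.2 < 0 := by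
  decide +kernel

/-- The coefficient `2` is needed: the half-plane trace `{(1, 0), (0, 1), (1, -1)}` requires `c.1 >
c.2 > 0`. -/
lemma exists_smallForm_eq : ∀ E ∈ Φ.powerset, IsSumClosed E → 3 ≤ E.card →
    ∃ c ∈ smallForms, ∀ w ∈ Φ, 0 ≤ c.1 * w.1 + c.2 * w.2 ↔ w ∈ E := by
  decide +kernel

lemma card_isSumClosed : (Φ.powerset.filter IsSumClosed).card = 29 := by decide +kernel

lemma card_isSumClosed_three_le :
    (Φ.powerset.filter fun E => IsSumClosed E ∧ 3 ≤ E.card).card = 13 := by decide +kernel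

lemma card_isSumClosed_not_three_le :
    (Φ.powerset.filter fun E => IsSumClosed E ∧ ¬ 3 ≤ E.card).card = 16 := by decide +kernel

/-- The homomorphism `ℤ² → ℤ` with the given coefficients. -/
def form (c : ℤ × ℤ) : ℤ × ℤ →+ ℤ :=
  (AddMonoidHom.mulLeft c.1).coprod (AddMonoidHom.mulLeft c.2)

/-- Long sums could a priori leave `Φ` and come back to a new weight; separating forms exclude this.
The infinite closure thus becomes a decidable condition. -/
lemma isAdditivelyStable_iff {E : Finset (ℤ × ℤ)} : IsAdditivelyStable E ↔ IsSumClosed E := by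
  refine ⟨fun ⟨h, h'⟩ => ⟨h, fun x hx y hy hxy => ?_⟩, fun h => ⟨h.1, ?_⟩⟩
  · have : x + y ∈ (E : Set (ℤ × ℤ)) := by
      rw [← h']
      exact ⟨add_mem (AddSubmonoid.subset_closure hx) (AddSubmonoid.subset_closure hy), hxy⟩
    exact this
  · refine Set.Subset.antisymm (fun w hw => ?_)
      fun w hw => ⟨AddSubmonoid.subset_closure hw, h.1 hw⟩
    by_contra hwE
    obtain ⟨c, -, hc, hcw⟩ :=
      exists_smallForm_separating E (Finset.mem_powerset.mpr h.1) h w hw.2 hwE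
    have hle : AddSubmonoid.closure (E : Set (ℤ × ℤ)) ≤ (AddSubmonoid.nonneg ℤ).comap (form c) :=
      AddSubmonoid.closure_le.mpr hc
    exact absurd (hle hw.1) (not_le.mpr hcw)

/-- Of a weight and its opposite, a half-plane contains at least one. -/
lemma three_le_card_of_form {E : Finset (ℤ × ℤ)} (f : ℤ × ℤ →+ ℤ)
    (h : ∀ w ∈ Φ, 0 ≤ f w ↔ w ∈ E) : 3 ≤ E.card := by
  have hneg : ∀ w ∈ Φ, -w ∈ Φ := by decide
  have hsub : Φ ⊆ E ∪ E.image Neg.neg := fun w hw => by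
    rw [Finset.mem_union, Finset.mem_image]
    rcases le_total 0 (f w) with h0 | h0
    · exact Or.inl ((h w hw).mp h0)
    · refine Or.inr ⟨-w, (h _ (hneg w hw)).mp ?_, neg_neg w⟩
      rw [map_neg]
      exact neg_nonneg.mpr h0
  have h6 : Φ.card = 6 := by decide
  have := (Finset.card_le_card hsub).trans (Finset.card_union_le _ _)
  have := Finset.card_image_le (s := E) (f := Neg.neg)
  omega

/-! ### Pure and lambdafiable magnets -/

lemma closure_inter_of_isSumClosed {E : Finset (ℤ × ℤ)} (hE : IsSumClosed E) {w : ℤ × ℤ}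
    (hw : w ∈ Φ) : w ∈ AddSubmonoid.closure (E : Set (ℤ × ℤ)) ↔ w ∈ E := by
  have h : w ∈ (AddSubmonoid.closure (E : Set (ℤ × ℤ)) : Set (ℤ × ℤ)) ∩ Φ ↔
      w ∈ (E : Set (ℤ × ℤ)) := by
    rw [(isAdditivelyStable_iff.mpr hE).2]
  exact ⟨fun h' => h.mp ⟨h', hw⟩, fun h' => (h.mpr h').1⟩

lemma isPure_closure {E : Finset (ℤ × ℤ)} (hE : IsSumClosed E) :
    IsPure doubleScalarAction (AddSubmonoid.closure (E : Set (ℤ × ℤ))) := by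
  refine ⟨rfl, fun N' hN' => AddSubmonoid.closure_le.mpr fun w hw => ?_⟩
  exact (attractor_eq_iff.mp hN' w (hE.1 hw)).mp (AddSubmonoid.subset_closure hw)

/-- The monoid generated by `N ∩ Φ` lies in `N` and has the same attractor, so a pure `N` equals it.
-/
lemma isPure_iff {N : AddSubmonoid (ℤ × ℤ)} :
    IsPure doubleScalarAction N ↔
      ∃ E, IsSumClosed E ∧ AddSubmonoid.closure (E : Set (ℤ × ℤ)) = N := by
  classical
  refine ⟨fun h => ⟨Φ.filter (· ∈ N), ?_, ?_⟩, ?_⟩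
  · refine ⟨Finset.filter_subset _ _, fun x hx y hy hxy => ?_⟩
    exact Finset.mem_filter.mpr
      ⟨hxy, add_mem (Finset.mem_filter.mp hx).2 (Finset.mem_filter.mp hy).2⟩
  · have hle : AddSubmonoid.closure ((Φ.filter (· ∈ N) : Finset (ℤ × ℤ)) : Set (ℤ × ℤ)) ≤ N :=
      AddSubmonoid.closure_le.mpr fun w hw => (Finset.mem_filter.mp hw).2
    refine le_antisymm hle (h.2 (attractor_eq_iff.mpr fun w hw => ⟨fun hwN => ?_, @hle w⟩))
    exact AddSubmonoid.subset_closure (Finset.mem_filter.mpr ⟨hw, hwN⟩)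
  · rintro ⟨E, hE, rfl⟩
    exact isPure_closure hE

lemma isLambdafiable_closure_iff {E : Finset (ℤ × ℤ)} (hE : IsSumClosed E) :
    IsLambdafiable doubleScalarAction (AddSubmonoid.closure (E : Set (ℤ × ℤ))) ↔ 3 ≤ E.card := by
  refine ⟨fun ⟨f, hf⟩ => ?_, fun h => ?_⟩
  · refine three_le_card_of_form f fun w hw => ?_
    rw [← closure_inter_of_isSumClosed hE hw]
    exact attractor_eq_iff.mp hf w hw
  · obtain ⟨c, -, hc⟩ := exists_smallForm_eq E (Finset.mem_powerset.mpr hE.1) hE h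
    refine ⟨form c, attractor_eq_iff.mpr fun w hw => ?_⟩
    rw [closure_inter_of_isSumClosed hE hw]
    exact hc w hw

/-- Counting pure magnets amounts to counting sum-closed subsets of `Φ`. -/
lemma ncard_closure_image (p : Finset (ℤ × ℤ) → Prop) [DecidablePred p]
    (q : AddSubmonoid (ℤ × ℤ) → Prop)
    (hq : ∀ E, IsSumClosed E → (q (AddSubmonoid.closure (E : Set (ℤ × ℤ))) ↔ p E)) :
    {N | IsPure doubleScalarAction N ∧ q N}.ncard =
      (Φ.powerset.filter fun E => IsSumClosed E ∧ p E).card := by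
  have himage : {N | IsPure doubleScalarAction N ∧ q N} =
      (fun E : Finset (ℤ × ℤ) => AddSubmonoid.closure (E : Set (ℤ × ℤ))) ''
        (Φ.powerset.filter fun E => IsSumClosed E ∧ p E : Finset (Finset (ℤ × ℤ))) := by
    ext N
    simp only [Set.mem_ofPred_eq, isPure_iff, Set.mem_image, Finset.mem_coe, Finset.mem_filter,
      Finset.mem_powerset]
    constructor
    · rintro ⟨⟨E, hE, rfl⟩, hN⟩
      exact ⟨E, ⟨hE.1, hE, (hq E hE).mp hN⟩, rfl⟩
    · rintro ⟨E, ⟨-, hE, hpE⟩, rfl⟩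
      exact ⟨⟨E, hE, rfl⟩, (hq E hE).mpr hpE⟩
  -- Injectivity holds because a sum-closed `E` is recovered as `[E⟩ ∩ Φ`.
  rw [himage, Set.InjOn.ncard_image, Set.ncard_coe_finset]
  intro E hE E' hE' h
  have hE := (Finset.mem_filter.mp hE).2.1
  have hE' := (Finset.mem_filter.mp hE').2.1
  have key : ∀ w ∈ Φ, w ∈ E ↔ w ∈ E' := fun w hw => by
    rw [← closure_inter_of_isSumClosed hE hw, ← closure_inter_of_isSumClosed hE' hw]
    exact iff_of_eq (congrArg (w ∈ ·) h)
  ext w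
  exact ⟨fun hw => (key w (hE.1 hw)).mp hw, fun hw => (key w (hE'.1 hw)).mpr hw⟩

end Magnetism

end

theorem mainTheorem3 :
    (∀ E : Finset (ℤ × ℤ), Magnetism.IsAdditivelyStable E →
      Magnetism.IsPure Magnetism.doubleScalarAction (AddSubmonoid.closure (E : Set (ℤ × ℤ))) ∧
      (Magnetism.IsLambdafiable Magnetism.doubleScalarAction
          (AddSubmonoid.closure (E : Set (ℤ × ℤ))) ↔ 3 ≤ E.card)) ∧
    {N : AddSubmonoid (ℤ × ℤ) | Magnetism.IsPure Magnetism.doubleScalarAction N}.ncard = 29 ∧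
    {N : AddSubmonoid (ℤ × ℤ) | Magnetism.IsPure Magnetism.doubleScalarAction N ∧
      Magnetism.IsLambdafiable Magnetism.doubleScalarAction N}.ncard = 13 ∧
    {N : AddSubmonoid (ℤ × ℤ) | Magnetism.IsPure Magnetism.doubleScalarAction N ∧
      ¬ Magnetism.IsLambdafiable Magnetism.doubleScalarAction N}.ncard = 16 := by
  refine ⟨fun E hE => ?_, ?_, ?_, ?_⟩
  · have hE := Magnetism.isAdditivelyStable_iff.mp hE
    exact ⟨Magnetism.isPure_closure hE, Magnetism.isLambdafiable_closure_iff hE⟩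
  · have h := Magnetism.ncard_closure_image (fun _ => True) (fun _ => True) fun _ _ => Iff.rfl
    simp only [and_true] at h
    exact h.trans Magnetism.card_isSumClosed
  · exact (Magnetism.ncard_closure_image _ _
      fun E hE => Magnetism.isLambdafiable_closure_iff hE).trans
        Magnetism.card_isSumClosed_three_le
  · exact (Magnetism.ncard_closure_image _ _
      fun E hE => not_congr (Magnetism.isLambdafiable_closure_iff hE)).trans
        Magnetism.card_isSumClosed_not_three_le
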